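/- All graphs are finite, simple and undirected. For a graph $G$ and a total order $\le$ of $V(G)$, a (simple) path from $v$ to $x$ is *$r$-admissible* if $x<v$, every inner vertex $w$ of the path satisfies $w>v$, and the path has at most $r$ edges. An *$r$-admissible path packing rooted at $v$* is a collection of $r$-admissible paths starting at $v$ that are pairwise vertex-disjoint except for $v$. The *$r$-admissibility* $\mathrm{adm}_r(G)$ is the minimum, over all total orders of $V(G)$, of the maximum size of an $r$-admissible path packing rooted at a vertex of $G$; let $\mathcal A^p_r$ be the family of all graphs $G$ with $\mathrm{adm}_r(G)\le p$. A *random neighbour oracle* for $G$ answers each query $v\in V(G)$ with an independent, uniformly random neighbour of $v$ (and with a special symbol if $v$ has no neighbour). A graph $G$ on $n$ vertices is *$\epsilon$-far* from $H$-freeness (containing no copy of $H$ as a subgraph) if at least $\epsilon n$ edges must be added to or removed from $G$ to make it $H$-free. A *one-sided error tester* for $H$-freeness on a family $\mathcal G$ of graphs is a randomized adaptive query algorithm that receives $n\ge 1$, $\epsilon>0$ and random neighbour oracle access (its only access to the graph) to a graph $G\in\mathcal G$ with vertex set $[n]$; it accepts with probability $1$ if $G$ is $H$-free, and rejects with probability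 at least $2/3$ if $G$ is $\epsilon$-far from $H$-freeness. Its *query complexity* is the maximum number of oracle queries it makes. **Theorem.** There is a function $q(\epsilon,p,r)$ such that for every graph $H$ and every integer $p\ge 2$, with $r=|V(H)|$, there is a one-sided error tester for $H$-freeness on $\mathcal A^p_r$ whose query complexity is at most $q(\epsilon,p,r)$ for all $n$ and $\epsilon$. In particular, $H$-freeness is testable on $\mathcal A^p_r$ with query complexity independent of $n$. -/

import Mathlib

namespace GraphTesting

universe u

section Admissibility

variable {V : Type u}

/-- A path `v P x` of `G` is `r`-admissible for the vertex order `L` if `x < v`, every inner vertex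
`w` satisfies `v < w`, and its length (number of edges) is at most `r`. -/
def IsAdmissiblePath (G : SimpleGraph V) (L : LinearOrder V) (r : ℕ) {v x : V}
    (P : G.Walk v x) : Prop :=
  P.IsPath ∧ L.lt x v ∧ (∀ w ∈ P.support, w ≠ v → w ≠ x → L.lt v w) ∧ P.length ≤ r

/-- An `r`-admissible path packing rooted at `v`: a finite collection of `r`-admissible paths
starting at `v` which are pairwise vertex-disjoint after removal of the common root `v`. -/
def IsPathPacking (G : SimpleGraph V) (L : LinearOrder V) (r : ℕ) (v : V)
    (S : Finset (Σ x : V, G.Walk v x)) : Prop :=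
  (∀ P ∈ S, IsAdmissiblePath G L r P.2) ∧
    (S : Set (Σ x : V, G.Walk v x)).Pairwise
      fun P Q => P.2.support.tail.Disjoint Q.2.support.tail

/-- The maximum size of an `r`-admissible path packing rooted at `v`. -/
noncomputable def packingNumber (G : SimpleGraph V) (L : LinearOrder V) (r : ℕ) (v : V) : ℕ∞ :=
  ⨆ (S : Finset (Σ x : V, G.Walk v x)) (_ : IsPathPacking G L r v S), (S.card : ℕ∞)

/-- The `r`-admissibility of the ordered graph `(G, L)`. -/
noncomputable def orderedAdmissibility (G : SimpleGraph V) (L : LinearOrder V) (r : ℕ) : ℕ∞ :=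
  ⨆ v : V, packingNumber G L r v

/-- The `r`-admissibility of `G`: the minimum over all total orders of its vertices. -/
noncomputable def admissibility (G : SimpleGraph V) (r : ℕ) : ℕ∞ :=
  ⨅ L : LinearOrder V, orderedAdmissibility G L r

end Admissibility

/-- A family of graphs with vertex sets of the form `Fin n`. -/
abbrev GraphFamily : Type := ∀ n : ℕ, Set (SimpleGraph (Fin n))

/-- The family of all `(p, r)`-admissible graphs. -/
def admissibleFamily (p r : ℕ) : GraphFamily :=
  fun _ => {G | admissibility G r ≤ (p : ℕ∞)}

/-- The property of containing no copy of `H` as a (not necessarily induced) subgraph. -/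
def freeFamily {W : Type u} (H : SimpleGraph W) : GraphFamily :=
  fun _ => {G | H.Free G}

/-- `G` is `ε`-far from the property `P`: at least `ε * n` edges must be added to `G` or removed
from `G` to obtain a graph in `P`. -/
def IsFar (P : GraphFamily) (ε : ℝ) {n : ℕ} (G : SimpleGraph (Fin n)) : Prop :=
  ∀ G' ∈ P n, ε * (n : ℝ) ≤ ((symmDiff G.edgeSet G'.edgeSet).ncard : ℝ)

/-- Randomized adaptive query algorithms on graphs with vertex set `Fin n`, as finite decision
trees: the algorithm can halt with a verdict, make an internal uniform random choice among
`m + 1` possibilities, or query the oracle at a vertex and continue depending on the answer. -/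
inductive Algorithm (n : ℕ) : Type
  | accept : Algorithm n
  | reject : Algorithm n
  | choose (m : ℕ) (next : Fin (m + 1) → Algorithm n) : Algorithm n
  | query (v : Fin n) (next : Option (Fin n) → Algorithm n) : Algorithm n

open Classical in
/-- The random neighbour oracle: the answer to the query `v` is a uniformly random neighbour
of `v`, and the symbol `none` if `v` has no neighbour. -/
noncomputable def randomNeighbour {n : ℕ} (G : SimpleGraph (Fin n)) (v : Fin n) :
    PMF (Option (Fin n)) :=
  if h : (Finset.univ.filter fun u => G.Adj v u).Nonempty then
    (PMF.uniformOfFinset (Finset.univ.filter fun u => G.Adj v u) h).map some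
  else PMF.pure none

namespace Algorithm

/-- The distribution of the verdict (`true` for accept, `false` for reject) when the algorithm is
run on `G`; all oracle answers and internal choices are independent. -/
noncomputable def run {n : ℕ} (G : SimpleGraph (Fin n)) : Algorithm n → PMF Bool
  | accept => PMF.pure true
  | reject => PMF.pure false
  | choose m next => (PMF.uniformOfFintype (Fin (m + 1))).bind fun i => run G (next i)
  | query v next => (randomNeighbour G v).bind fun a => run G (next a)

/-- The maximum number of oracle queries, over all internal choices and all oracle answers. -/
def maxQueries {n : ℕ} : Algorithm n → ℕ
  | accept => 0
  | reject => 0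
  | choose _ next => Finset.univ.sup fun i => maxQueries (next i)
  | query _ next => 1 + Finset.univ.sup fun a => maxQueries (next a)

end Algorithm

/-- `T`, which receives the number `n` of vertices and the proximity parameter `ε`, is a property
tester with one-sided error for the property `P` on the family `F`. -/
def IsOneSidedTester (P F : GraphFamily) (T : ∀ n : ℕ, ℝ → Algorithm n) : Prop :=
  ∀ (n : ℕ) (ε : ℝ), 0 < n → 0 < ε → ∀ G ∈ F n,
    (G ∈ P n → (T n ε).run G true = 1) ∧
    (IsFar P ε G → 2 / 3 ≤ (T n ε).run G false)

/-- `P` is testable with one-sided error on `F`, by a tester whose query complexity is at most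
`q ε` for the proximity parameter `ε`, whatever the size of the input graph. -/
def IsTestable (P F : GraphFamily) (q : ℝ → ℕ) : Prop :=
  ∃ T : ∀ n : ℕ, ℝ → Algorithm n, IsOneSidedTester P F T ∧
    ∀ (n : ℕ) (ε : ℝ), 0 < ε → (T n ε).maxQueries ≤ q ε

end GraphTesting

namespace GraphTesting

/-! If `G` is far from `H`-free, a maximum family of edge-disjoint copies of `H` has linearly many
members, since deleting their edges destroys all copies. Fix an order witnessing the admissibility.
Each vertex has at most `p` smaller neighbours, so few edges join two vertices of degree above a
large constant `D`; copies using such edges are discarded. After a renaming of the vertices of `H`,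
a constant fraction of the copies lists its vertices of degree above `D` first, sorted by rank, and
for some colouring of `G` a constant fraction of these has its vertex `i` coloured `i`.

At a vertex of degree at most `D`, a random neighbour continues a given copy with constant
probability. At a vertex `x = f a` of larger degree it may belong to another copy through `x`. That
copy is just as good if it agrees with `f` on the `front` of `a`, that is, on the earlier vertices
attached to the component of `a` among the later ones. Admissibility leaves boundedly many
candidates for the images of the front (`card_targets_le`). So few copies need to be discarded until
each one shares `x` and its front with a family of at least `θ * deg x` copies
(`exists_pruned_copies`). By edge-disjointness these use different neighbours of `x`, so a random
query moves to one of them with constant probability. This makes the family `Explorable`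
(`explorable_of_pruned`).

In an explorable family a bounded number of successful experiments reveals `H`
(`exists_attains_isContained`): pieces of different copies that agree on fronts are glued, and the
colours keep the glued map injective. The tester experiments at random and rejects only if its log
contains `H`, so its error is one-sided. A bounded number of experiments all succeed with
probability bounded below, and repetition amplifies this (`acc_tester_le`). -/

/-! ### Sequences of favourable random experiments. -/

open Classical in
/-- The set of neighbours of a vertex. -/
noncomputable def nbrs {n : ℕ} (G : SimpleGraph (Fin n)) (v : Fin n) : Finset (Fin n) :=
  Finset.univ.filter fun u => G.Adj v u

theorem mem_nbrs {n : ℕ} {G : SimpleGraph (Fin n)} {v u : Fin n} : u ∈ nbrs G v ↔ G.Adj v u := by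
  simp [nbrs]

/-- The number of neighbours of a vertex. -/
noncomputable def deg {n : ℕ} (G : SimpleGraph (Fin n)) (v : Fin n) : ℕ := (nbrs G v).card

/-- The graph formed by the pairs of a query log. -/
def logGraph {n : ℕ} (st : List (Fin n × Fin n)) : SimpleGraph (Fin n) :=
  SimpleGraph.fromRel fun u v => (u, v) ∈ st

/-- From the log `st`, at most `t` further random experiments (picking a random vertex, or asking
for a random neighbour of a known vertex), each with a fraction of at least `η` of favourable
outcomes, lead to a log with property `Q`. -/
def Attains {n : ℕ} (G : SimpleGraph (Fin n)) (η : ℝ) (Q : List (Fin n × Fin n) → Prop) :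
    ℕ → List (Fin n × Fin n) → Prop
  | 0, st => Q st
  | t + 1, st => Q st ∨
      (∃ A : Finset (Fin n), η * n ≤ A.card ∧ ∀ v ∈ A, Attains G η Q t ((v, v) :: st)) ∨
      ∃ v ∈ st.map Prod.snd, ∃ A : Finset (Fin n), A.Nonempty ∧ η * deg G v ≤ A.card ∧
        ∀ u ∈ A, G.Adj v u ∧ Attains G η Q t ((v, u) :: st)

namespace Attains

variable {n : ℕ} {G : SimpleGraph (Fin n)} {η : ℝ} {Q R : List (Fin n × Fin n) → Prop}

theorem of_prop {t : ℕ} {st : List (Fin n × Fin n)} (h : Q st) : Attains G η Q t st := by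
  cases t with
  | zero => exact h
  | succ t => exact Or.inl h

theorem bind {t t' : ℕ} : ∀ {st : List (Fin n × Fin n)}, Attains G η Q t st →
    (∀ st', st ⊆ st' → Q st' → Attains G η R t' st') → Attains G η R (t' + t) st := by
  induction t with
  | zero => intro st h h'; exact h' st (List.Subset.refl _) h
  | succ t ih =>
    have mono : ∀ (s : ℕ) (st : List (Fin n × Fin n)), Attains G η R s st →
        Attains G η R (s + 1) st := by
      intro s
      induction s with
      | zero => intro st h; exact Or.inl h
      | succ s ihs =>
        rintro st (h | ⟨A, hA, h⟩ | ⟨v, hv, A, hA, hA', h⟩)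
        · exact Or.inl h
        · exact Or.inr (Or.inl ⟨A, hA, fun v hv => ihs _ (h v hv)⟩)
        · exact Or.inr (Or.inr ⟨v, hv, A, hA, hA', fun u hu => ⟨(h u hu).1, ihs _ (h u hu).2⟩⟩)
    have mono' : ∀ (j : ℕ) (st : List (Fin n × Fin n)), Attains G η R t' st →
        Attains G η R (t' + j) st := by
      intro j
      induction j with
      | zero => intro st h; exact h
      | succ j ihj => intro st h; exact mono _ _ (ihj st h)
    rintro st (h | ⟨A, hA, h⟩ | ⟨v, hv, A, hA, hA', h⟩) h'
    · exact mono' _ _ (h' st (List.Subset.refl _) h)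
    · exact Or.inr (Or.inl ⟨A, hA, fun v hv => ih (h v hv) fun st' hst =>
        h' st' fun x hx => hst (List.mem_cons_of_mem _ hx)⟩)
    · exact Or.inr (Or.inr ⟨v, hv, A, hA, hA', fun u hu => ⟨(h u hu).1, ih (h u hu).2 fun st' hst =>
        h' st' fun x hx => hst (List.mem_cons_of_mem _ hx)⟩⟩)

theorem weaken {t : ℕ} {st : List (Fin n × Fin n)} (h : Attains G η Q t st)
    (h' : ∀ st', st ⊆ st' → Q st' → R st') : Attains G η R t st := by
  have := bind (t' := 0) h fun st' hst hQ => (h' st' hst hQ : Attains G η R 0 st')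
  simpa using this

theorem mono {t t' : ℕ} {st : List (Fin n × Fin n)} (h : Attains G η Q t st) (ht : t ≤ t') :
    Attains G η Q t' st := by
  obtain ⟨d, rfl⟩ := Nat.exists_eq_add_of_le' ht
  exact bind h fun st' _ hQ => of_prop hQ

/-- The goals are pursued one after the other; those already reached survive because logs only grow.
Each must be attainable from every extension of `st`, as the earlier pursuits have enlarged the log.
-/
theorem forall_mem {ι : Type*} (I : Finset ι) (t : ι → ℕ) {P : ι → List (Fin n × Fin n) → Prop}
    (hP : ∀ i st st', st ⊆ st' → P i st → P i st') :
    ∀ {st : List (Fin n × Fin n)},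
      (∀ i ∈ I, ∀ st', st ⊆ st' → Attains G η (P i) (t i) st') →
      Attains G η (fun st' => ∀ i ∈ I, P i st') (∑ i ∈ I, t i) st := by
  classical
  induction I using Finset.induction_on with
  | empty => intro st _; exact of_prop (by simp)
  | insert i I hi ih =>
    intro st h
    rw [Finset.sum_insert hi]
    refine bind (ih fun j hj => h j (Finset.mem_insert_of_mem hj)) fun st' hst hQ => ?_
    refine (h i (Finset.mem_insert_self _ _) st' hst).weaken fun st'' hst' hi' j hj => ?_
    rcases Finset.mem_insert.1 hj with rfl | hj
    · exact hi'
    · exact hP j st' st'' hst' (hQ j hj)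

end Attains

/-! ### Exploring a coloured family of maps. -/

section Exploration

variable {r : ℕ}

/-- The subgraph of `H` induced by the vertices from `k` on. -/
def upper (H : SimpleGraph (Fin r)) (k : ℕ) : SimpleGraph (Fin r) where
  Adj u v := H.Adj u v ∧ k ≤ u.val ∧ k ≤ v.val
  symm := ⟨fun _ _ h => ⟨h.1.symm, h.2.2, h.2.1⟩⟩
  loopless := ⟨fun _ h => h.1.ne rfl⟩

/-- The vertices below `a` that are adjacent to the component of `a` among the vertices from `a`
on. -/
def front (H : SimpleGraph (Fin r)) (a : Fin r) : Set (Fin r) :=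
  {s | s < a ∧ ∃ w, (upper H a).Reachable a w ∧ H.Adj w s}

theorem upper_le (H : SimpleGraph (Fin r)) (k : ℕ) : upper H k ≤ H := fun _ _ h => h.1

theorem le_of_upper_reachable {H : SimpleGraph (Fin r)} {k : ℕ} {v w : Fin r}
    (h : (upper H k).Reachable v w) (hv : k ≤ v.val) : k ≤ w.val := by
  obtain ⟨p⟩ := h
  induction p with
  | nil => exact hv
  | cons h _ ih => exact ih h.2.2

theorem upper_reachable_succ {H : SimpleGraph (Fin r)} {k : ℕ} {v w : Fin r}
    (h : (upper H k).Reachable v w) (hv : k < v.val)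
    (hk : ∀ u : Fin r, u.val = k → ¬ (upper H k).Reachable v u) :
    (upper H (k + 1)).Reachable v w := by
  obtain ⟨p⟩ := h
  induction p with
  | nil => exact SimpleGraph.Reachable.refl _
  | @cons v u w h _ ih =>
    have hu : k < u.val := lt_of_le_of_ne h.2.2 fun e => hk u e.symm h.reachable
    have : (upper H (k + 1)).Adj v u := ⟨h.1, hv, hu⟩
    exact this.reachable.trans (ih hu fun u' hu' hr => hk u' hu' (h.reachable.trans hr))

theorem upper_reachable_cases {H : SimpleGraph (Fin r)} {k : ℕ} {a w : Fin r} (hk : a.val = k)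
    (h : (upper H k).Reachable a w) :
    w = a ∨ ∃ b, H.Adj a b ∧ a < b ∧ (upper H (k + 1)).Reachable b w := by
  obtain ⟨p⟩ := h.symm
  clear h
  induction p with
  | nil => exact Or.inl rfl
  | @cons w u a h p ih =>
    refine or_iff_not_imp_left.2 fun hw => ?_
    have hw' : k < w.val := lt_of_le_of_ne h.2.1 fun e => hw (Fin.ext (by omega))
    rcases ih hk with rfl | ⟨b, hb, hb', hr⟩
    · exact ⟨w, h.1.symm, Fin.lt_def.2 (by omega), SimpleGraph.Reachable.refl _⟩
    · have hu : k < u.val := le_of_upper_reachable hr (by have := Fin.lt_def.1 hb'; omega)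
      have : (upper H (k + 1)).Adj u w := ⟨h.1.symm, hu, hw'⟩
      exact ⟨b, hb, hb', hr.trans this.reachable⟩

/-- A family of maps from `Fin r` to `G`, coloured by `c`, whose members can be explored by random
queries: a random neighbour of `φ a` is, with a probability of at least `η`, the image of a given
neighbour of `a` under a member which agrees with `φ` on `a` and on its front; and from each edge
of `H`, the images of one of its ends make up a fraction of at least `η` of all vertices. -/
structure Explorable {n : ℕ} (H : SimpleGraph (Fin r)) (G : SimpleGraph (Fin n)) (η : ℝ)
    (c : Fin n → Fin r) (F : Set (Fin r → Fin n)) : Prop where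
  color : ∀ φ ∈ F, ∀ i, c (φ i) = i
  step : ∀ φ ∈ F, ∀ a b, H.Adj a b → ∃ A : Finset (Fin n), A.Nonempty ∧
    η * deg G (φ a) ≤ A.card ∧ ∀ u ∈ A, G.Adj (φ a) u ∧
      ∃ φ' ∈ F, φ' b = u ∧ φ' a = φ a ∧ ∀ s ∈ front H a, φ' s = φ s
  start : ∀ a b, H.Adj a b → ∃ b', (b' = a ∨ b' = b) ∧ ∃ A : Finset (Fin n),
    η * n ≤ A.card ∧ ∀ v ∈ A, ∃ φ ∈ F, φ b' = v

/-- From the image of `a` under a member of an explorable family one can get to the image of `b`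
under the same member. -/
def Leads (H : SimpleGraph (Fin r)) (a b : Fin r) : Prop :=
  ∃ t, ∀ {n : ℕ} (G : SimpleGraph (Fin n)) (η : ℝ) (c : Fin n → Fin r) (F : Set (Fin r → Fin n)),
    Explorable H G η c F → ∀ φ ∈ F, ∀ st : List (Fin n × Fin n), φ a ∈ st.map Prod.snd →
      Attains G η (fun st' => φ b ∈ st'.map Prod.snd) t st

theorem Leads.refl (H : SimpleGraph (Fin r)) (a : Fin r) : Leads H a a :=
  ⟨0, fun _ _ _ _ _ _ _ _ h => h⟩

theorem Leads.trans {H : SimpleGraph (Fin r)} {a b d : Fin r} (h : Leads H a b)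
    (h' : Leads H b d) : Leads H a d := by
  obtain ⟨t, ht⟩ := h
  obtain ⟨t', ht'⟩ := h'
  exact ⟨t' + t, fun G η c F hF φ hφ st hst =>
    (ht G η c F hF φ hφ st hst).bind fun st' _ hst' => ht' G η c F hF φ hφ st' hst'⟩

/-- One may move from `a` to a neighbour `b`, and then on to a vertex in the front of `a`. -/
theorem Leads.of_adj {H : SimpleGraph (Fin r)} {a b s : Fin r} (h : H.Adj a b)
    (hs : s ∈ front H a) (h' : Leads H b s) : Leads H a s := by
  obtain ⟨t, ht⟩ := h'
  refine ⟨t + 1, fun {n} G η c F hF φ hφ st hst => ?_⟩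
  obtain ⟨A, hA, hA', h⟩ := hF.step φ hφ a b h
  refine Or.inr (Or.inr ⟨φ a, hst, A, hA, hA', fun u hu => ⟨(h u hu).1, ?_⟩⟩)
  obtain ⟨-, φ', hφ', rfl, -, hfr⟩ := h u hu
  rw [← hfr s hs]
  exact ht G η c F hF φ' hφ' _ (by simp)

/-- Follow the walk as long as it stays in the component of `b` among the vertices from `b` on. When
it drops below `b`, the vertex reached lies in the front of `b`, so one can move there and restart
with it in place of `b`. -/
theorem Leads.of_walk {H : SimpleGraph (Fin r)} {k : ℕ}
    (hP : ∀ a : Fin r, k < a.val → ∀ s ∈ front H a, Leads H a s) {w s : Fin r} (p : H.Walk w s)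
    (hs : s.val ≤ k) (hp : ∀ v ∈ p.support, v = s ∨ k < v.val) :
    ∀ b : Fin r, k < b.val → (upper H b).Reachable b w → Leads H b s := by
  induction p with
  | nil =>
    intro b hb hr
    have := le_of_upper_reachable hr le_rfl
    omega
  | @cons w w' s h p ih =>
    intro b hb hr
    have hw := le_of_upper_reachable hr le_rfl
    have hp' : ∀ v ∈ p.support, v = s ∨ k < v.val := fun v hv => hp v (by simp [hv])
    rcases le_or_gt b.val w'.val with hbw | hbw
    · have : (upper H b).Adj w w' := ⟨h, hw, hbw⟩
      exact ih hs hp' b hb (hr.trans this.reachable)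
    · have hl : Leads H b w' := hP b hb w' ⟨hbw, w, hr, h⟩
      rcases hp' w' (by simp) with rfl | hk
      · exact hl
      · exact hl.trans (ih hs hp' w' hk (SimpleGraph.Reachable.refl _))

/-- Downward induction on `a`. A step from `a` to a neighbour may change the member of the family
but not the image of `s`, so the goal stays the same. The remaining way to `s` passes through
vertices above `a`, whose fronts are covered by induction. -/
theorem Leads.of_mem_front {H : SimpleGraph (Fin r)} (a : Fin r) :
    ∀ s ∈ front H a, Leads H a s := by
  induction hd : r - a.val using Nat.strong_induction_on generalizing a with
  | _ d ih =>
  rintro s ⟨hs, w, hr, hw⟩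
  have hP : ∀ a' : Fin r, a.val < a'.val → ∀ s ∈ front H a', Leads H a' s := fun a' ha' =>
    ih (r - a'.val) (by omega) a' rfl
  rcases upper_reachable_cases rfl hr with rfl | ⟨b, hb, hab, hbr⟩
  · exact Leads.of_adj hw ⟨hs, w, hr, hw⟩ (Leads.refl H s)
  · refine Leads.of_adj hb ⟨hs, w, hr, hw⟩ ?_
    obtain ⟨p⟩ := hbr
    refine Leads.of_walk hP ((p.mapLe (upper_le H _)).concat hw) hs.le ?_ b hab
      (SimpleGraph.Reachable.refl _)
    intro v hv
    rw [SimpleGraph.Walk.support_concat] at hv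
    replace hv : v ∈ p.support ∨ v = s := by simpa using hv
    rcases hv with hv | hv
    · right
      exact le_of_upper_reachable ⟨p.takeUntil v hv⟩ hab
    · exact Or.inl hv

theorem Leads.of_reachable {H : SimpleGraph (Fin r)} {k : ℕ} {a v : Fin r} (hk : a.val = k)
    (hv : k ≤ v.val) (h : (upper H k).Reachable v a) : Leads H v a := by
  rcases eq_or_ne v a with rfl | hva
  · exact Leads.refl H v
  · obtain ⟨p⟩ := h
    refine Leads.of_walk (k := k) (fun a' _ => Leads.of_mem_front a') (p.mapLe (upper_le H _))
      hk.le (fun u hu => ?_) v (lt_of_le_of_ne hv fun e => hva (Fin.ext (by omega)))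
      (SimpleGraph.Reachable.refl _)
    have := le_of_upper_reachable ⟨p.takeUntil u (by simpa using hu)⟩ hv
    rcases eq_or_ne u a with rfl | hua
    · exact Or.inl rfl
    · exact Or.inr (lt_of_le_of_ne this fun e => hua (Fin.ext (by omega)))

/-- The pair `u`, `v` occurs in the log `st`. -/
def Seen {n : ℕ} (st : List (Fin n × Fin n)) (u v : Fin n) : Prop :=
  (u, v) ∈ st ∨ (v, u) ∈ st

/-- The log `st` contains a coloured image of all edges of `H` which touch the component of `v`
among the vertices from `k` on, compatible with `φ` below `k`. -/
def Explored {n : ℕ} (H : SimpleGraph (Fin r)) (c : Fin n → Fin r) (k : ℕ) (v : Fin r)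
    (φ : Fin r → Fin n) (st : List (Fin n × Fin n)) : Prop :=
  ∃ ψ : Fin r → Fin n, (∀ i, c (ψ i) = i) ∧
    (∀ s : Fin r, s.val < k → ∀ w, (upper H k).Reachable v w → H.Adj w s → ψ s = φ s) ∧
    ∀ w, (upper H k).Reachable v w → ∀ w', H.Adj w w' → Seen st (ψ w) (ψ w')

theorem Seen.mono {n : ℕ} {st st' : List (Fin n × Fin n)} {u v : Fin n} (h : st ⊆ st')
    (hs : Seen st u v) : Seen st' u v := hs.imp (fun x => h x) fun x => h x

theorem Seen.symm {n : ℕ} {st : List (Fin n × Fin n)} {u v : Fin n} (hs : Seen st u v) :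
    Seen st v u := Or.symm hs

theorem Explored.mono {n : ℕ} {H : SimpleGraph (Fin r)} {c : Fin n → Fin r} {k : ℕ} {v : Fin r}
    {φ : Fin r → Fin n} {st st' : List (Fin n × Fin n)} (h : st ⊆ st')
    (hs : Explored H c k v φ st) : Explored H c k v φ st' := by
  obtain ⟨ψ, h1, h2, h3⟩ := hs
  exact ⟨ψ, h1, h2, fun w hw w' hw' => (h3 w hw w' hw').mono h⟩

/-- Different components above `k` are disjoint and not adjacent, so their images can be glued: each
component uses the map of one chosen representative, and all other vertices use `φ`, with which
these maps agree on the attached vertices below `k`. -/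
theorem explored_union {n : ℕ} {H : SimpleGraph (Fin r)} {c : Fin n → Fin r} {k : ℕ}
    {φ : Fin r → Fin n} {st : List (Fin n × Fin n)} (hφ : ∀ i, c (φ i) = i) (B : Set (Fin r))
    (hB : ∀ b ∈ B, k ≤ b.val) (h : ∀ b ∈ B, Explored H c k b φ st) :
    ∃ ψ : Fin r → Fin n, (∀ i, c (ψ i) = i) ∧
      (∀ v, (¬ ∃ b ∈ B, (upper H k).Reachable b v) → ψ v = φ v) ∧
      ∀ b ∈ B, ∀ w, (upper H k).Reachable b w → ∀ w', H.Adj w w' → Seen st (ψ w) (ψ w') := by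
  classical
  have : Nonempty (Fin r → Fin n) := ⟨φ⟩
  choose! ψ h1 h2 h3 using h
  let P : Fin r → Fin r → Prop := fun v b => b ∈ B ∧ (upper H k).Reachable b v
  let χ : Fin r → Fin n := fun v => if h : ∃ b, P v b then ψ h.choose v else φ v
  have hχ : ∀ v (h : ∃ b, P v b), χ v = ψ h.choose v := fun v h => dif_pos h
  have hχ' : ∀ v, (¬ ∃ b, P v b) → χ v = φ v := fun v h => dif_neg h
  refine ⟨χ, fun i => ?_, hχ', fun b hb w hr w' hw => ?_⟩
  · by_cases h : ∃ b, P i b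
    · rw [hχ i h]; exact h1 _ h.choose_spec.1 i
    · rw [hχ' i h]; exact hφ i
  · have hP : ∃ b, P w b := ⟨b, hb, hr⟩
    have hPc := hP.choose_spec
    have key := h3 _ hPc.1 w hPc.2 w' hw
    rw [hχ w hP]
    rcases le_or_gt k w'.val with hk | hk
    · have hadj : (upper H k).Adj w w' := ⟨hw, le_of_upper_reachable hr (hB b hb), hk⟩
      -- Equality of the predicates makes the representatives chosen at `w` and at `w'` coincide.
      have hPP : P w' = P w := funext fun b' => propext
        ⟨fun h => ⟨h.1, h.2.trans hadj.symm.reachable⟩, fun h => ⟨h.1, h.2.trans hadj.reachable⟩⟩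
      have hP' : ∃ b, P w' b := hPP ▸ hP
      have : hP'.choose = hP.choose := by congr
      rw [hχ w' hP', this]
      exact key
    · rw [hχ' w' fun ⟨b', hb', hr'⟩ => absurd (le_of_upper_reachable hr' (hB b' hb')) (by omega),
        ← h2 _ hPc.1 w' hk w hPc.2 hw]
      exact key

/-- Downward induction on `k`. If the component of `v` contains the vertex `k`, go there, query it
once for each of its neighbours `b`, and explore the components of the larger `b` recursively. The
members reached vary with `b`, but all agree with `φ` on `k` and its front, hence wherever the
smaller components are attached. That `t` is fixed before `n` and `G` is what frees the query
complexity of `n`. -/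
theorem exists_attains_explored (H : SimpleGraph (Fin r)) (k : ℕ) : ∀ v : Fin r, k ≤ v.val →
    ∃ t, ∀ {n : ℕ} (G : SimpleGraph (Fin n)) (η : ℝ) (c : Fin n → Fin r) (F : Set (Fin r → Fin n)),
      Explorable H G η c F → ∀ φ ∈ F, ∀ st : List (Fin n × Fin n), φ v ∈ st.map Prod.snd →
        Attains G η (Explored H c k v φ) t st := by
  classical
  induction hd : r - k using Nat.strong_induction_on generalizing k with
  | _ d ih =>
  intro v hv
  have hkr : k < r := lt_of_le_of_lt hv v.isLt
  obtain ⟨κ, hκ⟩ : ∃ κ : Fin r, κ.val = k := ⟨⟨k, hkr⟩, rfl⟩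
  have ih' := ih (r - (k + 1)) (by omega) (k + 1) rfl
  by_cases hreach : (upper H k).Reachable v κ
  swap
  · have hvk : k < v.val := lt_of_le_of_ne hv fun e => hreach (by
      rw [show v = κ from Fin.ext (by omega)])
    obtain ⟨t, ht⟩ := ih' v hvk
    refine ⟨t, fun G η c F hF φ hφ st hst => (ht G η c F hF φ hφ st hst).weaken ?_⟩
    rintro st' - ⟨ψ, h1, h2, h3⟩
    have hr : ∀ w, (upper H k).Reachable v w → (upper H (k + 1)).Reachable v w := fun w hw =>
      upper_reachable_succ hw hvk fun u hu => by
        rw [show u = κ from Fin.ext (by omega)]; exact hreach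
    exact ⟨ψ, h1, fun s hs w hw => h2 s (by omega) w (hr w hw), fun w hw => h3 w (hr w hw)⟩
  · obtain ⟨t₀, ht₀⟩ := Leads.of_reachable hκ hv hreach
    have ht : ∀ b : Fin r, ∃ t, κ < b → ∀ {n : ℕ} (G : SimpleGraph (Fin n)) (η : ℝ)
        (c : Fin n → Fin r) (F : Set (Fin r → Fin n)), Explorable H G η c F → ∀ φ ∈ F,
        ∀ st : List (Fin n × Fin n), φ b ∈ st.map Prod.snd →
          Attains G η (Explored H c (k + 1) b φ) t st := by
      intro b
      by_cases hb : κ < b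
      · obtain ⟨t, ht⟩ := ih' b (by have := Fin.lt_def.1 hb; omega)
        exact ⟨t, fun _ => ht⟩
      · exact ⟨0, fun h => absurd h hb⟩
    choose t ht using ht
    let I : Finset (Fin r) := Finset.univ.filter fun b => H.Adj κ b
    refine ⟨(∑ b ∈ I, (t b + 1)) + t₀, fun {n} G η c F hF φ hφ st hst =>
      (ht₀ G η c F hF φ hφ st hst).bind fun st₁ _ hst₁ => ?_⟩
    let P : Fin r → List (Fin n × Fin n) → Prop := fun b st =>
      if κ < b then Explored H c (k + 1) b φ st else Seen st (φ κ) (φ b)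
    have hPm : ∀ b st st', st ⊆ st' → P b st → P b st' := by
      intro b st st' hss hb
      by_cases h : κ < b
      · simp only [P, if_pos h] at hb ⊢; exact hb.mono hss
      · simp only [P, if_neg h] at hb ⊢; exact hb.mono hss
    have hstep : ∀ b ∈ I, ∀ st', st₁ ⊆ st' → Attains G η (P b) (t b + 1) st' := by
      intro b hb st' hst'
      have hb : H.Adj κ b := by simpa [I] using hb
      obtain ⟨A, hA, hA', h⟩ := hF.step φ hφ κ b hb
      refine Or.inr (Or.inr ⟨φ κ, ?_, A, hA, hA', fun u hu => ⟨(h u hu).1, ?_⟩⟩)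
      · obtain ⟨x, hx, hx'⟩ := List.mem_map.1 hst₁
        exact List.mem_map.2 ⟨x, hst' hx, hx'⟩
      · obtain ⟨-, φ', hφ', rfl, hκ', hfr⟩ := h u hu
        by_cases hlt : κ < b
        · refine (ht b hlt G η c F hF φ' hφ' _ (by simp)).weaken fun st'' _ hex => ?_
          simp only [P, if_pos hlt]
          obtain ⟨ψ, h1, h2, h3⟩ := hex
          refine ⟨ψ, h1, fun s hs w hw hadj => ?_, h3⟩
          rw [h2 s hs w hw hadj]
          rcases eq_or_ne s κ with rfl | hsκ
          · exact hκ'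
          · have hsk : s < κ := Fin.lt_def.2
              (lt_of_le_of_ne (by omega) fun e => hsκ (Fin.ext e))
            -- The component of `b` above `κ` is part of the component of `κ`, so what is attached
            -- to it below `κ` is in the front of `κ`.
            refine hfr s ⟨hsk, w, ?_, hadj⟩
            have hκb : (upper H κ).Adj κ b := ⟨hb, le_rfl, (Fin.lt_def.1 hlt).le⟩
            refine hκb.reachable.trans (hw.mono fun x y hxy => ?_)
            exact ⟨hxy.1, by have := hxy.2.1; omega, by have := hxy.2.2; omega⟩
        · have hbκ : b < κ := lt_of_le_of_ne (not_lt.1 hlt) hb.ne.symm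
          refine Attains.of_prop ?_
          simp only [P, if_neg hlt]
          left
          -- A smaller neighbour of `κ` lies in its front, so the favourable answer is its image
          -- under `φ` itself.
          rw [hfr b ⟨hbκ, κ, SimpleGraph.Reachable.refl _, hb⟩]
          simp
    refine (Attains.forall_mem I (fun b => t b + 1) hPm hstep).weaken fun st₂ _ hall => ?_
    obtain ⟨ψ, h1, h2, h3⟩ := explored_union (k := k + 1) (hF.color φ hφ)
      {b | H.Adj κ b ∧ κ < b} (fun b hb => by have := Fin.lt_def.1 hb.2; omega) (fun b hb => by
        have := hall b (by simpa [I] using hb.1)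
        simpa only [P, if_pos hb.2] using this)
    have hlow : ∀ s : Fin r, s.val ≤ k → ψ s = φ s := fun s hs => h2 s fun ⟨b, hb, hr⟩ => by
      have := le_of_upper_reachable hr (by have := Fin.lt_def.1 hb.2; omega)
      omega
    refine ⟨ψ, h1, fun s hs _ _ _ => hlow s hs.le, fun w hw w' hadj => ?_⟩
    rcases upper_reachable_cases hκ (hreach.symm.trans hw) with rfl | ⟨b, hb, hlt, hr⟩
    · by_cases hlt : w < w'
      · exact (h3 w' ⟨hadj, hlt⟩ w' (SimpleGraph.Reachable.refl _) w hadj.symm).symm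
      · have := hall w' (by simpa [I] using hadj)
        simp only [P, if_neg hlt] at this
        rw [hlow w hκ.le, hlow w' (by have := Fin.le_def.1 (not_lt.1 hlt); omega)]
        exact this
    · exact h3 b ⟨hb, hlt⟩ w hr w' hadj

/-- The number of experiments needed to find a copy of `H` in an explorable family does not depend
on the family. -/
theorem exists_attains_isContained (H : SimpleGraph (Fin r)) : ∃ t, ∀ {n : ℕ}
    (G : SimpleGraph (Fin n)) (η : ℝ) (c : Fin n → Fin r) (F : Set (Fin r → Fin n)),
      Explorable H G η c F → F.Nonempty → Attains G η (fun st => H.IsContained (logGraph st)) t [] := by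
  classical
  choose t ht using fun v : Fin r => exists_attains_explored H 0 v (Nat.zero_le _)
  let I : Finset (Fin r) := Finset.univ.filter fun v => ∃ w, H.Adj v w
  -- Which end of an edge `start` provides depends on the family; `T` bounds the exploration from
  -- either end.
  let T : ℕ := ∑ v, t v
  have hT : ∀ v, t v ≤ T := fun v => Finset.single_le_sum (f := t) (by simp) (Finset.mem_univ v)
  refine ⟨∑ v ∈ I, (T + 1), fun {n} G η c F hF ⟨φ, hφ⟩ => ?_⟩
  refine (Attains.forall_mem I (fun _ => T + 1) (P := fun v => Explored H c 0 v φ)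
    (fun v st st' hss h => h.mono hss) fun v hv st _ => ?_).weaken fun st _ hall => ?_
  · obtain ⟨w, hw⟩ : ∃ w, H.Adj v w := by simpa [I] using hv
    obtain ⟨b, hb, A, hA, h⟩ := hF.start v w hw
    refine Or.inr (Or.inl ⟨A, hA, fun u hu => ?_⟩)
    obtain ⟨φ', hφ', rfl⟩ := h u hu
    refine ((ht b G η c F hF φ' hφ' _ (by simp)).mono (hT b)).weaken fun st' _ hex => ?_
    obtain ⟨ψ, h1, -, h3⟩ := hex
    -- For `k = 0` agreement with `φ` is vacuous, so pieces from unrelated members can be combined.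
    refine ⟨ψ, h1, fun s hs => absurd hs (Nat.not_lt_zero _), fun x hx => h3 x ?_⟩
    rcases hb with rfl | rfl
    · exact hx
    · have : (upper H 0).Adj b v := ⟨hw.symm, Nat.zero_le _, Nat.zero_le _⟩
      exact this.reachable.trans hx
  · obtain ⟨ψ, h1, -, h3⟩ := explored_union (hF.color φ hφ) (k := 0) {v | ∃ w, H.Adj v w}
      (fun _ _ => Nat.zero_le _) (fun b hb => hall b (by simpa [I] using hb))
    have hinj : Function.Injective ψ := fun i j hij => by rw [← h1 i, ← h1 j, hij]
    refine ⟨⟨⟨ψ, fun {a b} hab => ?_⟩, hinj⟩⟩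
    rw [logGraph, SimpleGraph.fromRel_adj]
    exact ⟨hinj.ne hab.ne, h3 a ⟨b, hab⟩ a (SimpleGraph.Reachable.refl _) b hab⟩

end Exploration
-- Acceptance probabilities.
namespace Algorithm

/-- The probability that the algorithm accepts. -/
noncomputable def acc {n : ℕ} (G : SimpleGraph (Fin n)) (T : Algorithm n) : ℝ :=
  (T.run G true).toReal

variable {n : ℕ} {G : SimpleGraph (Fin n)}

theorem acc_nonneg (T : Algorithm n) : 0 ≤ T.acc G := ENNReal.toReal_nonneg

theorem acc_accept : (accept : Algorithm n).acc G = 1 := by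
  simp [acc, run]

theorem acc_reject : (reject : Algorithm n).acc G = 0 := by
  simp [acc, run]

theorem acc_choose (m : ℕ) (next : Fin (m + 1) → Algorithm n) :
    (choose m next).acc G = (∑ i, (next i).acc G) / (m + 1 : ℕ) := by
  simp only [acc, run, PMF.bind_apply, PMF.uniformOfFintype_apply, tsum_fintype,
    Fintype.card_fin]
  rw [← Finset.mul_sum, ENNReal.toReal_mul, ENNReal.toReal_sum fun i _ => PMF.apply_ne_top _ _,
    ENNReal.toReal_inv, ENNReal.toReal_natCast]
  field_simp

theorem acc_query_of_pos (v : Fin n) (next : Option (Fin n) → Algorithm n) (hv : 0 < deg G v) :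
    (query v next).acc G =
      (∑ u ∈ nbrs G v, (next (some u)).acc G) / deg G v := by
  classical
  have hne : (nbrs G v).Nonempty := Finset.card_pos.1 hv
  have hr : randomNeighbour G v = (PMF.uniformOfFinset (nbrs G v) hne).map some := dif_pos hne
  simp only [acc, run, hr, PMF.bind_map, PMF.bind_apply,
    tsum_fintype, Function.comp, PMF.uniformOfFinset_apply]
  rw [ENNReal.toReal_sum fun i _ => ENNReal.mul_ne_top
    (by split_ifs <;> simp [hne.card_pos.ne']) (PMF.apply_ne_top _ _), nbrs,
    Finset.sum_filter, Finset.sum_div]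
  refine Finset.sum_congr rfl fun u _ => ?_
  by_cases hu : G.Adj v u
  · simp [hu, deg, nbrs, div_eq_inv_mul]
  · simp [hu]

theorem acc_query_of_eq_zero (v : Fin n) (next : Option (Fin n) → Algorithm n)
    (hv : deg G v = 0) : (query v next).acc G = (next none).acc G := by
  have hne : ¬ (nbrs G v).Nonempty := fun h => (Finset.card_pos.2 h).ne' hv
  have hr : randomNeighbour G v = PMF.pure none := dif_neg hne
  simp only [acc, run, hr, PMF.pure_bind]

theorem run_false_eq (T : Algorithm n) : (T.run G false).toReal = 1 - T.acc G := by
  have h := (T.run G).tsum_coe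
  rw [tsum_bool] at h
  have := congrArg ENNReal.toReal h
  rw [ENNReal.toReal_add (PMF.apply_ne_top _ _) (PMF.apply_ne_top _ _)] at this
  simp only [ENNReal.toReal_one] at this
  rw [acc]
  linarith

end Algorithm

/-- Averages of quantities at most `x`, a fraction `η` of which is at most `(1 - γ) x`. -/
theorem sum_div_le {ι : Type*} {s A : Finset ι} (hA : A ⊆ s) {f : ι → ℝ} {x γ η : ℝ}
    (hx : 0 ≤ x) (hγ : 0 ≤ γ) (hs : 0 < s.card) (hη : η * s.card ≤ A.card) (hf : ∀ i ∈ s, f i ≤ x)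
    (hfA : ∀ i ∈ A, f i ≤ (1 - γ) * x) : (∑ i ∈ s, f i) / s.card ≤ (1 - η * γ) * x := by
  classical
  rw [div_le_iff₀ (by exact_mod_cast hs), ← Finset.sum_sdiff hA]
  have h1 : ∑ i ∈ s \ A, f i ≤ ((s \ A).card : ℝ) * x := by
    rw [← nsmul_eq_mul]
    exact Finset.sum_le_card_nsmul _ _ _ fun i hi => hf i (Finset.mem_sdiff.1 hi).1
  have h2 : ∑ i ∈ A, f i ≤ (A.card : ℝ) * ((1 - γ) * x) := by
    rw [← nsmul_eq_mul]
    exact Finset.sum_le_card_nsmul _ _ _ hfA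
  have h3 : ((s \ A).card : ℝ) + A.card = s.card := by
    exact_mod_cast Finset.card_sdiff_add_card_eq_card hA
  have h4 : η * s.card * (γ * x) ≤ A.card * (γ * x) :=
    mul_le_mul_of_nonneg_right hη (mul_nonneg hγ hx)
  have h5 : ((s \ A).card : ℝ) = s.card - A.card := by linarith
  rw [h5] at h1
  linarith

/-! ### The search algorithm and its repetition. -/

section Search

variable {r m : ℕ}

open Classical in
/-- At most `t` random experiments, looking for a copy of `H`, before continuing with `K`. -/
noncomputable def search (H : SimpleGraph (Fin r)) (K : Algorithm (m + 1)) :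
    ℕ → List (Fin (m + 1) × Fin (m + 1)) → Algorithm (m + 1)
  | 0, st => if H.IsContained (logGraph st) then .reject else K
  | t + 1, st => if H.IsContained (logGraph st) then .reject else
      .choose st.length fun i =>
        if h : i.val < st.length then
          .query (st[i.val]).2 fun o => search H K t (((st[i.val]).2, o.getD (st[i.val]).2) :: st)
        else .choose m fun v => search H K t ((v, v) :: st)

variable (H : SimpleGraph (Fin r)) (K : Algorithm (m + 1))

theorem maxQueries_search (t : ℕ) : ∀ st : List (Fin (m + 1) × Fin (m + 1)),
    (search H K t st).maxQueries ≤ t + K.maxQueries := by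
  induction t with
  | zero =>
    intro st
    rw [search]
    split_ifs <;> simp [Algorithm.maxQueries]
  | succ t ih =>
    intro st
    rw [search]
    split_ifs
    · simp [Algorithm.maxQueries]
    · rw [Algorithm.maxQueries]
      refine Finset.sup_le fun i _ => ?_
      split_ifs with h
      · rw [Algorithm.maxQueries]
        have : (Finset.univ.sup fun o : Option (Fin (m + 1)) => (search H K t
          (((st[i.val]).2, o.getD (st[i.val]).2) :: st)).maxQueries) ≤ t + K.maxQueries :=
          Finset.sup_le fun o _ => ih _
        omega
      · rw [Algorithm.maxQueries]
        exact Finset.sup_le fun v _ => (ih _).trans (by omega)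

/-- The distinct vertices in the pairs of the log are adjacent. -/
def IsLog (G : SimpleGraph (Fin (m + 1))) (st : List (Fin (m + 1) × Fin (m + 1))) : Prop :=
  ∀ e ∈ st, e.1 ≠ e.2 → G.Adj e.1 e.2

variable {H K} {G : SimpleGraph (Fin (m + 1))}

theorem IsLog.cons {st : List (Fin (m + 1) × Fin (m + 1))} (h : IsLog G st) {u v : Fin (m + 1)}
    (huv : u ≠ v → G.Adj u v) : IsLog G ((u, v) :: st) := by
  intro e he
  rcases List.mem_cons.1 he with rfl | he
  · exact huv
  · exact h e he

theorem IsLog.logGraph_le {st : List (Fin (m + 1) × Fin (m + 1))} (h : IsLog G st) :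
    logGraph st ≤ G := by
  intro u v huv
  rw [logGraph, SimpleGraph.fromRel_adj] at huv
  rcases huv.2 with h' | h'
  · exact h _ h' huv.1
  · exact (h _ h' huv.1.symm).symm

/-- The log records only loops and edges of `G`, so its graph never contains `H` and every branch
ends in `K`. -/
theorem acc_search_of_free (hG : H.Free G) (t : ℕ) :
    ∀ st : List (Fin (m + 1) × Fin (m + 1)), IsLog G st → (search H K t st).acc G = K.acc G := by
  have hfree : ∀ st : List (Fin (m + 1) × Fin (m + 1)), IsLog G st →
      ¬ H.IsContained (logGraph st) := fun st hst h =>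
    hG (h.trans (SimpleGraph.IsContained.of_le hst.logGraph_le))
  induction t with
  | zero => intro st hst; rw [search, if_neg (hfree st hst)]
  | succ t ih =>
    intro st hst
    rw [search, if_neg (hfree st hst), Algorithm.acc_choose, Finset.sum_congr rfl
      (g := fun _ => K.acc G)]
    · rw [Finset.sum_const, Finset.card_univ, Fintype.card_fin, nsmul_eq_mul]
      field_simp
    · intro i _
      split_ifs with h
      · set v := (st[i.val]).2
        rcases Nat.eq_zero_or_pos (deg G v) with hv | hv
        · rw [Algorithm.acc_query_of_eq_zero _ _ hv]
          exact ih _ (hst.cons fun h => absurd rfl h)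
        · rw [Algorithm.acc_query_of_pos _ _ hv, Finset.sum_congr rfl (g := fun _ => K.acc G)]
          · rw [Finset.sum_const, nsmul_eq_mul]
            change ((deg G v : ℕ) : ℝ) * _ / _ = _
            field_simp
          · intro u hu
            exact ih _ (hst.cons fun _ => mem_nbrs.1 hu)
      · rw [Algorithm.acc_choose, Finset.sum_congr rfl (g := fun _ => K.acc G)]
        · rw [Finset.sum_const, Finset.card_univ, Fintype.card_fin, nsmul_eq_mul]
          field_simp
        · intro v _
          exact ih _ (hst.cons fun h => absurd rfl h)

theorem acc_query_le {v : Fin (m + 1)} {next : Option (Fin (m + 1)) → Algorithm (m + 1)} {x : ℝ}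
    (h : ∀ o, (next o).acc G ≤ x) : (Algorithm.query v next).acc G ≤ x := by
  rcases Nat.eq_zero_or_pos (deg G v) with hv | hv
  · rw [Algorithm.acc_query_of_eq_zero _ _ hv]; exact h _
  · rw [Algorithm.acc_query_of_pos _ _ hv, div_le_iff₀ (by exact_mod_cast hv), mul_comm,
      ← nsmul_eq_mul]
    exact Finset.sum_le_card_nsmul _ _ _ fun u _ => h _

theorem acc_choose_le {k : ℕ} {next : Fin (k + 1) → Algorithm (m + 1)} {x : ℝ}
    (h : ∀ o, (next o).acc G ≤ x) : (Algorithm.choose k next).acc G ≤ x := by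
  rw [Algorithm.acc_choose, div_le_iff₀ (by positivity), mul_comm, ← nsmul_eq_mul]
  simpa using Finset.sum_le_card_nsmul Finset.univ (fun i => (next i).acc G) x fun u _ => h _

theorem acc_search_le (t : ℕ) :
    ∀ st : List (Fin (m + 1) × Fin (m + 1)), (search H K t st).acc G ≤ K.acc G := by
  induction t with
  | zero =>
    intro st
    rw [search]
    split_ifs
    · rw [Algorithm.acc_reject]; exact Algorithm.acc_nonneg K
    · exact le_rfl
  | succ t ih =>
    intro st
    rw [search]
    split_ifs
    · rw [Algorithm.acc_reject]; exact Algorithm.acc_nonneg K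
    · refine acc_choose_le fun i => ?_
      split_ifs with h
      · exact acc_query_le fun o => ih _
      · exact acc_choose_le fun v => ih _

/-- As the log has at most `T` entries, an experiment is of the right kind with probability at least
`1 / (T + 1)`, and then favourable with probability at least `η`; `t` successes suffice for
rejection. All other branches do no worse than `K`. -/
theorem acc_search_le_of_attains {η : ℝ} (hη : 0 ≤ η) (hη1 : η ≤ 1) (T t : ℕ) :
    ∀ st : List (Fin (m + 1) × Fin (m + 1)), st.length + t ≤ T →
      Attains G η (fun st => H.IsContained (logGraph st)) t st →
      (search H K t st).acc G ≤ (1 - (η / (T + 1 : ℕ)) ^ t) * K.acc G := by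
  have hK : 0 ≤ K.acc G := Algorithm.acc_nonneg K
  have hq0 : 0 ≤ η / (T + 1 : ℕ) := by positivity
  have hq1 : η / (T + 1 : ℕ) ≤ 1 := by
    rw [div_le_one (by positivity)]
    push_cast
    linarith [Nat.cast_nonneg (α := ℝ) T]
  have hfound : ∀ t (st : List (Fin (m + 1) × Fin (m + 1))), H.IsContained (logGraph st) →
      (search H K t st).acc G ≤ (1 - (η / (T + 1 : ℕ)) ^ t) * K.acc G := by
    intro t st h
    have : (search H K t st).acc G = 0 := by
      cases t <;> rw [search, if_pos h, Algorithm.acc_reject]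
    rw [this]
    exact mul_nonneg (sub_nonneg.2 (pow_le_one₀ hq0 hq1)) hK
  induction t with
  | zero =>
    intro st _ h
    exact hfound 0 st h
  | succ t ih =>
    intro st hlen h
    by_cases hc : H.IsContained (logGraph st)
    · exact hfound _ st hc
    set γ := (η / (T + 1 : ℕ)) ^ t with hγ
    have hγ0 : 0 ≤ γ := pow_nonneg hq0 t
    rw [search, if_neg hc, Algorithm.acc_choose]
    -- It suffices to improve the bound for a single one of the at most `T + 1` kinds of experiment.
    have key : ∀ i : Fin (st.length + 1),
        (if h : i.val < st.length then
          Algorithm.query (st[i.val]).2 fun o =>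
            search H K t (((st[i.val]).2, o.getD (st[i.val]).2) :: st)
        else .choose m fun v => search H K t ((v, v) :: st)).acc G ≤ (1 - η * γ) * K.acc G →
        (∑ i : Fin (st.length + 1), (if h : i.val < st.length then
          Algorithm.query (st[i.val]).2 fun o =>
            search H K t (((st[i.val]).2, o.getD (st[i.val]).2) :: st)
        else .choose m fun v => search H K t ((v, v) :: st)).acc G) / (st.length + 1 : ℕ) ≤
          (1 - (η / (T + 1 : ℕ)) ^ (t + 1)) * K.acc G := by
      intro i hi
      have := sum_div_le (s := Finset.univ) (A := {i}) (η := 1 / (T + 1 : ℕ)) (γ := η * γ)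
        (Finset.subset_univ _) hK (mul_nonneg hη hγ0) (by simp) (by
          simp only [Finset.card_univ, Fintype.card_fin, Finset.card_singleton, Nat.cast_one]
          rw [div_mul_eq_mul_div, one_mul, div_le_one (by positivity)]
          exact_mod_cast (by omega : st.length + 1 ≤ T + 1)) (f := fun i => (if h : i.val < st.length then
          Algorithm.query (st[i.val]).2 fun o =>
            search H K t (((st[i.val]).2, o.getD (st[i.val]).2) :: st)
        else .choose m fun v => search H K t ((v, v) :: st)).acc G) (fun j _ => by
          split_ifs with h
          · exact acc_query_le fun o => acc_search_le t _
          · exact acc_choose_le fun v => acc_search_le t _) (fun j hj => by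
          rw [Finset.mem_singleton.1 hj]; exact hi)
      simp only [Finset.card_univ, Fintype.card_fin] at this
      refine this.trans (le_of_eq ?_)
      rw [pow_succ, ← hγ]
      ring
    rcases h with h | ⟨A, hA, h⟩ | ⟨v, hv, A, hA, hA', h⟩
    · exact absurd h hc
    · refine key ⟨st.length, Nat.lt_succ_self _⟩ ?_
      rw [dif_neg (lt_irrefl _), Algorithm.acc_choose]
      have := sum_div_le (s := Finset.univ) (A := A) (η := η) (γ := γ)
        (Finset.subset_univ _) hK hγ0 (by simp) (by simpa using hA)
        (f := fun v => (search H K t ((v, v) :: st)).acc G) (fun v _ => acc_search_le t _)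
        (fun v hv => ih _ (by simp; omega) (h v hv))
      simpa using this
    · obtain ⟨e, he, rfl⟩ := List.mem_map.1 hv
      obtain ⟨i, hi, rfl⟩ := List.getElem_of_mem he
      refine key ⟨i, by omega⟩ ?_
      rw [dif_pos hi]
      have hAs : A ⊆ nbrs G (st[i]).2 := fun u hu => mem_nbrs.2 (h u hu).1
      have hd : 0 < deg G (st[i]).2 := Finset.card_pos.2 (hA.mono hAs)
      rw [Algorithm.acc_query_of_pos _ _ hd]
      exact sum_div_le (η := η) (γ := γ) hAs hK hγ0 hd hA'
        (f := fun u => (search H K t (((st[i]).2, (some u).getD (st[i]).2) :: st)).acc G)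
        (fun u _ => acc_search_le t _)
        (fun u hu => ih _ (by simp; omega) (h u hu).2)

/-- `N` independent searches, of `t` experiments each. -/
noncomputable def tester (H : SimpleGraph (Fin r)) (m t : ℕ) : ℕ → Algorithm (m + 1)
  | 0 => .accept
  | N + 1 => search H (tester H m t N) t []

theorem maxQueries_tester (t N : ℕ) : (tester H m t N).maxQueries ≤ N * t := by
  induction N with
  | zero => simp [tester, Algorithm.maxQueries]
  | succ N ih =>
    rw [tester]
    refine (maxQueries_search H _ t []).trans ?_
    rw [Nat.succ_mul]
    omega

theorem acc_tester_of_free (hG : H.Free G) (t N : ℕ) : (tester H m t N).acc G = 1 := by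
  induction N with
  | zero => exact Algorithm.acc_accept
  | succ N ih =>
    rw [tester, acc_search_of_free hG t [] (fun e he => absurd he List.not_mem_nil), ih]

theorem acc_tester_le {η : ℝ} (hη : 0 ≤ η) (hη1 : η ≤ 1) (t N : ℕ)
    (h : Attains G η (fun st => H.IsContained (logGraph st)) t []) :
    (tester H m t N).acc G ≤ (1 - (η / (t + 1 : ℕ)) ^ t) ^ N := by
  have hq0 : 0 ≤ η / (t + 1 : ℕ) := by positivity
  have hq1 : η / (t + 1 : ℕ) ≤ 1 := by
    rw [div_le_one (by positivity)]
    push_cast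
    linarith [Nat.cast_nonneg (α := ℝ) t]
  induction N with
  | zero => rw [tester, Algorithm.acc_accept]; simp
  | succ N ih =>
    rw [tester, pow_succ, mul_comm]
    exact (acc_search_le_of_attains hη hη1 t t [] (by simp) h).trans
      (mul_le_mul_of_nonneg_left ih (sub_nonneg.2 (pow_le_one₀ hq0 hq1)))

end Search

/-! ### Admissible orders: sparsity and bounded sets of targets. -/

section Order

variable {n : ℕ} {G : SimpleGraph (Fin n)} {r p : ℕ}

/-- `Fin n` already carries an order, so the optimal order is also encoded by an injective rank with
values in `ℕ`. -/
theorem exists_order_of_admissibility_le (h : admissibility G r ≤ (p : ℕ∞)) :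
    ∃ (L : LinearOrder (Fin n)) (rk : Fin n → ℕ), Function.Injective rk ∧
      (∀ u v, L.lt u v ↔ rk u < rk v) ∧
      ∀ v S, IsPathPacking G L r v S → S.card ≤ p := by
  classical
  have : Nonempty (LinearOrder (Fin n)) := ⟨inferInstance⟩
  obtain ⟨L, hL⟩ : ∃ L, orderedAdmissibility G L r = admissibility G r :=
    ciInf_mem fun L : LinearOrder (Fin n) => orderedAdmissibility G L r
  let rk : Fin n → ℕ := fun v => (Finset.univ.filter fun u => L.lt u v).card
  have hlt : ∀ u v, L.lt u v → rk u < rk v := fun u v huv => Finset.card_lt_card (by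
    rw [Finset.ssubset_iff_of_subset fun w hw => by
      simp only [Finset.mem_filter, Finset.mem_univ, true_and] at hw ⊢
      exact @lt_trans _ L.toPreorder _ _ _ hw huv]
    exact ⟨u, by simpa using huv, by simp⟩)
  have htri : ∀ u v, L.lt u v ∨ u = v ∨ L.lt v u := @lt_trichotomy _ L
  refine ⟨L, rk, fun u v huv => ?_, fun u v => ⟨hlt u v, fun h => ?_⟩, fun v S hS => ?_⟩
  · rcases htri u v with h | h | h
    · exact absurd (hlt _ _ h) (by omega)
    · exact h
    · exact absurd (hlt _ _ h) (by omega)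
  · rcases htri u v with h' | h' | h'
    · exact h'
    · subst h'; omega
    · exact absurd (hlt _ _ h') (by omega)
  · have h1 : (S.card : ℕ∞) ≤ packingNumber G L r v := le_iSup₂_of_le S hS le_rfl
    have h2 : packingNumber G L r v ≤ orderedAdmissibility G L r := le_iSup (packingNumber G L r) v
    exact_mod_cast (h1.trans h2).trans (hL.le.trans h)

variable {L : LinearOrder (Fin n)} {rk : Fin n → ℕ}

/-- The single edges to smaller neighbours form a packing. -/
theorem card_lower_nbrs_le (hr : 1 ≤ r) (hrk : ∀ u v, L.lt u v ↔ rk u < rk v)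
    (hp : ∀ v S, IsPathPacking G L r v S → S.card ≤ p) (v : Fin n) :
    ((nbrs G v).filter fun u => rk u < rk v).card ≤ p := by
  classical
  set N := (nbrs G v).filter fun u => rk u < rk v
  have hN : ∀ u ∈ N, G.Adj v u ∧ rk u < rk v := fun u hu =>
    ⟨mem_nbrs.1 (Finset.mem_filter.1 hu).1, (Finset.mem_filter.1 hu).2⟩
  let S : Finset (Σ x : Fin n, G.Walk v x) :=
    N.attach.image fun u => ⟨u.1, (hN u.1 u.2).1.toWalk⟩
  have hS : S.card = N.card := by
    rw [Finset.card_image_of_injective _ fun u w huw => ?_, Finset.card_attach]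
    exact Subtype.ext (congrArg Sigma.fst huw)
  rw [← hS]
  refine hp v S ⟨fun P hP => ?_, fun P hP Q hQ hPQ => ?_⟩
  · obtain ⟨⟨u, hu⟩, -, rfl⟩ := Finset.mem_image.1 hP
    have := hN u hu
    refine ⟨?_, (hrk _ _).2 this.2, fun w hw hwv hwu => ?_, ?_⟩
    · simpa using this.1.ne
    · simp at hw
      tauto
    · simpa using hr
  · obtain ⟨⟨u, hu⟩, -, rfl⟩ := Finset.mem_image.1 hP
    obtain ⟨⟨w, hw⟩, -, rfl⟩ := Finset.mem_image.1 hQ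
    simp only [SimpleGraph.Walk.support_cons, SimpleGraph.Walk.support_nil, List.tail_cons,
      List.disjoint_singleton, List.mem_singleton, SimpleGraph.Adj.toWalk]
    rintro rfl
    exact hPQ rfl

theorem sum_deg_le (hinj : Function.Injective rk)
    (hlow : ∀ v, ((nbrs G v).filter fun u => rk u < rk v).card ≤ p) :
    ∑ v, deg G v ≤ 2 * p * n := by
  classical
  have h1 : ∀ v, deg G v = ((nbrs G v).filter fun u => rk u < rk v).card +
      ((nbrs G v).filter fun u => rk v < rk u).card := by
    intro v
    rw [deg, ← Finset.card_filter_add_card_filter_not (fun u => rk u < rk v)]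
    congr 2
    refine Finset.filter_congr fun u hu => ?_
    have : rk u ≠ rk v := hinj.ne (mem_nbrs.1 hu).ne.symm
    omega
  have h2 : ∑ v, ((nbrs G v).filter fun u => rk v < rk u).card =
      ∑ v, ((nbrs G v).filter fun u => rk u < rk v).card := by
    have := Finset.sum_card_bipartiteAbove_eq_sum_card_bipartiteBelow
      (s := (Finset.univ : Finset (Fin n))) (t := (Finset.univ : Finset (Fin n)))
      (fun v u => G.Adj v u ∧ rk v < rk u)
    convert this using 3 with v _ v _
    · ext u; simp [mem_nbrs, Finset.bipartiteAbove]
    · ext u; simp [mem_nbrs, Finset.bipartiteBelow, G.adj_comm]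
  have h3 : ∑ v, ((nbrs G v).filter fun u => rk u < rk v).card ≤ n * p := by
    simpa using Finset.sum_le_card_nsmul Finset.univ _ p fun v _ => hlow v
  rw [Finset.sum_congr rfl fun v _ => h1 v, Finset.sum_add_distrib, h2]
  linarith

/-- A walk that ends in a set can be cut off where it first hits the set. -/
theorem exists_walk_until {V : Type*} {G : SimpleGraph V} (P : V → Prop) {u y : V}
    (q : G.Walk u y) (hq : q.IsPath) (hy : P y) : ∃ (z : V) (q' : G.Walk u z), q'.IsPath ∧ P z ∧
      (∀ w ∈ q'.support, w ≠ z → ¬ P w) ∧ q'.support ⊆ q.support ∧ q'.length ≤ q.length := by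
  induction q with
  | nil => exact ⟨_, .nil, .nil, hy, by simp, by simp, le_rfl⟩
  | @cons u v y h q ih =>
    by_cases hu : P u
    · exact ⟨u, .nil, .nil, hu, by simp, by simp, by simp⟩
    · rw [SimpleGraph.Walk.cons_isPath_iff] at hq
      obtain ⟨z, q', h1, h2, h3, h4, h5⟩ := ih hq.1 hy
      refine ⟨z, .cons h q', ?_, h2, fun w hw hwz => ?_, ?_, by simpa using h5⟩
      · rw [SimpleGraph.Walk.cons_isPath_iff]
        exact ⟨h1, fun h => hq.2 (h4 h)⟩
      · rcases (by simpa using hw : w = u ∨ w ∈ q'.support) with rfl | hw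
        · exact hu
        · exact h3 w hw hwz
      · simpa using List.cons_subset_cons _ h4

open Classical in
/-- The vertices outside `M` to which `u` is joined by a walk through `M` of length at most `l`. -/
noncomputable def targets (G : SimpleGraph (Fin n)) (M : Set (Fin n)) (l : ℕ) (u : Fin n) :
    Finset (Fin n) :=
  Finset.univ.filter fun y => y ∉ M ∧
    ∃ q : G.Walk u y, q.length ≤ l ∧ ∀ w ∈ q.support, w = y ∨ w ∈ M

theorem mem_targets {M : Set (Fin n)} {l : ℕ} {u y : Fin n} : y ∈ targets G M l u ↔ y ∉ M ∧
    ∃ q : G.Walk u y, q.length ≤ l ∧ ∀ w ∈ q.support, w = y ∨ w ∈ M := by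
  simp [targets]

theorem exists_maximum_packing (hp : ∀ v S, IsPathPacking G L r v S → S.card ≤ p) (v : Fin n) :
    ∃ S, IsPathPacking G L r v S ∧ ∀ S', IsPathPacking G L r v S' → S'.card ≤ S.card := by
  have hb : BddAbove {k | ∃ S, IsPathPacking G L r v S ∧ S.card = k} :=
    ⟨p, by rintro _ ⟨S, hS, rfl⟩; exact hp v S hS⟩
  obtain ⟨S, hS, hk⟩ := Nat.sSup_mem
    (s := {k | ∃ S, IsPathPacking G L r v S ∧ S.card = k})
    ⟨0, ∅, ⟨by simp, by simp⟩, by simp⟩ hb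
  exact ⟨S, hS, fun S' hS' => hk ▸ le_csSup hb ⟨S', hS', rfl⟩⟩

/-- Every path from `u ∈ M` to a target passes through one of at most `K` other vertices, from which
fewer steps remain. If `u` has degree at most `D`, these are its neighbours. Otherwise `rk x ≤ rk
u`, and they are the vertices of a maximum packing rooted at `u`: the target is smaller than `u`, so
the path, cut off at its first vertex below `u`, is admissible and by maximality meets the packing
outside `u`. -/
theorem card_targets_le (hrk : ∀ u v, L.lt u v ↔ rk u < rk v)
    (hp : ∀ v S, IsPathPacking G L r v S → S.card ≤ p) {D K : ℕ} (hK : 1 ≤ K) (hKD : D ≤ K)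
    (hKp : p * r ≤ K) (x : Fin n) (l : ℕ) (hl : l ≤ r) :
    ∀ u, (targets G {w | deg G w ≤ D ∨ rk x ≤ rk w} l u).card ≤ K ^ l := by
  classical
  set M : Set (Fin n) := {w | deg G w ≤ D ∨ rk x ≤ rk w} with hM
  induction l with
  | zero =>
    intro u
    refine (Finset.card_le_card (t := {u}) fun y hy => ?_).trans (by simp)
    obtain ⟨-, q, hq, -⟩ := mem_targets.1 hy
    exact Finset.mem_singleton.2 (SimpleGraph.Walk.eq_of_length_eq_zero (Nat.le_zero.1 hq)).symm
  | succ l ih =>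
    intro u
    by_cases hu : u ∈ M
    swap
    · refine (Finset.card_le_card (t := {u}) fun y hy => ?_).trans
        (by simpa using Nat.one_le_pow _ _ hK)
      obtain ⟨-, q, -, hq⟩ := mem_targets.1 hy
      rcases hq u q.start_mem_support with h | h
      · exact Finset.mem_singleton.2 h.symm
      · exact absurd h hu
    · suffices ∃ Z : Finset (Fin n), Z.card ≤ K ∧
          targets G M (l + 1) u ⊆ Z.biUnion (targets G M l) by
        obtain ⟨Z, hZ, hZ'⟩ := this
        calc _ ≤ _ := Finset.card_le_card hZ'
          _ ≤ Z.card * K ^ l := Finset.card_biUnion_le_card_mul _ _ _ fun z _ => ih (by omega) z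
          _ ≤ K ^ (l + 1) := by rw [pow_succ']; exact Nat.mul_le_mul_right _ hZ
      have hcons : ∀ y ∈ targets G M (l + 1) u, ∃ (v : Fin n) (h : G.Adj u v) (q : G.Walk v y),
          (SimpleGraph.Walk.cons h q).IsPath ∧ q.length ≤ l ∧ ∀ w ∈ q.support, w = y ∨ w ∈ M := by
        intro y hy
        obtain ⟨hyM, q, hq, hqM⟩ := mem_targets.1 hy
        have hq' : ∀ w ∈ q.bypass.support, w = y ∨ w ∈ M := fun w hw =>
          hqM w (q.support_bypass_subset_support hw)
        have hlen := q.length_bypass_le_length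
        have hpath := q.bypass_isPath
        revert hq' hlen hpath
        cases q.bypass with
        | nil => exact absurd hu hyM
        | cons h q' =>
          intro hq' hlen hpath
          rw [SimpleGraph.Walk.length_cons] at hlen
          exact ⟨_, h, q', hpath, by omega, fun w hw => hq' w (by simp [hw])⟩
      rcases hu with hu | hu
      · refine ⟨nbrs G u, le_trans hu hKD, fun y hy => ?_⟩
        obtain ⟨v, h, q, -, hql, hqM⟩ := hcons y hy
        exact Finset.mem_biUnion.2 ⟨v, mem_nbrs.2 h,
          mem_targets.2 ⟨(mem_targets.1 hy).1, q, hql, hqM⟩⟩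
      · obtain ⟨S, hS, hmax⟩ := exists_maximum_packing hp u
        refine ⟨S.biUnion fun P => P.2.support.tail.toFinset, ?_, fun y hy => ?_⟩
        · refine (Finset.card_biUnion_le_card_mul _ _ r fun P hP => ?_).trans
            ((Nat.mul_le_mul_right r (hp u S hS)).trans hKp)
          refine (List.toFinset_card_le _).trans ?_
          have := (hS.1 P hP).2.2.2
          simpa using this
        · obtain ⟨v, h, q, hpath, hql, hqM⟩ := hcons y hy
          have hyM := (mem_targets.1 hy).1
          have hyu : rk y < rk u := by
            simp only [hM, Set.mem_ofPred_eq, not_or, not_le] at hyM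
            omega
          obtain ⟨z, q', h1, h2, h3, h4, h5⟩ :=
            exists_walk_until (fun w => rk w < rk u) (.cons h q) hpath hyu
          have hadm : IsAdmissiblePath G L r q' := by
            refine ⟨h1, (hrk _ _).2 h2, fun w hw hwu hwz => (hrk _ _).2 ?_, ?_⟩
            · have h6 := h3 w hw hwz
              have h7 : rk w ≠ rk u := fun e => by
                rcases @lt_trichotomy _ L w u with h | h | h
                · exact absurd ((hrk _ _).1 h) (by omega)
                · exact hwu h
                · exact absurd ((hrk _ _).1 h) (by omega)
              omega
            · rw [SimpleGraph.Walk.length_cons] at h5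
              omega
          have hex : ∃ P ∈ S, ¬ q'.support.tail.Disjoint P.2.support.tail := by
            by_contra hcon
            push Not at hcon
            have hz : z ∈ q'.support.tail := by
              refine q'.end_mem_tail_support fun hnil => ?_
              have := hnil.eq
              subst this
              exact lt_irrefl _ h2
            have hnot : (⟨z, q'⟩ : Σ x : Fin n, G.Walk u x) ∉ S := fun hmem =>
              hcon _ hmem hz hz
            have := hmax (insert ⟨z, q'⟩ S) ⟨fun P hP => ?_, ?_⟩
            · rw [Finset.card_insert_of_notMem hnot] at this
              omega
            · rcases Finset.mem_insert.1 hP with rfl | hP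
              · exact hadm
              · exact hS.1 P hP
            · rw [Finset.coe_insert, Set.pairwise_insert]
              exact ⟨hS.2, fun P hP _ => ⟨hcon P hP, (hcon P hP).symm⟩⟩
          obtain ⟨P, hP, hdis⟩ := hex
          rw [List.disjoint_left] at hdis
          push Not at hdis
          obtain ⟨w, hw, hwP⟩ := hdis
          refine Finset.mem_biUnion.2 ⟨w, Finset.mem_biUnion.2 ⟨P, hP, by simpa using hwP⟩, ?_⟩
          have hwu : w ≠ u := by
            rintro rfl
            have := h1.support_nodup
            rw [← SimpleGraph.Walk.cons_tail_support] at this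
            exact (List.nodup_cons.1 this).1 hw
          have hwq : w ∈ q.support := by
            have := h4 (List.mem_of_mem_tail hw)
            simpa [hwu] using this
          refine mem_targets.2 ⟨hyM, q.dropUntil w hwq, ?_, fun w' hw' =>
            hqM w' (q.support_dropUntil_subset_support hwq hw')⟩
          exact (q.length_dropUntil_le_length hwq).trans hql

end Order

/-! ### Pruning and colouring of finite families. -/

/-- Discarding few members of a finite family, one can make sure that every class `i` of weight
`w i` which is met by the rest of the family has at least `w i` members in it. -/
theorem exists_pruned {α ι : Type*} [DecidableEq ι] (inc : α → Finset ι) (w : ι → ℝ)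
    (hw : ∀ i, 0 ≤ w i) (F : Finset α) : ∃ F' ⊆ F,
      (∀ f ∈ F', ∀ i ∈ inc f, w i ≤ ((F'.filter fun g => i ∈ inc g).card : ℝ)) ∧
      (F.card : ℝ) - F'.card ≤ ∑ i ∈ F.biUnion inc, w i := by
  classical
  induction F using Finset.strongInduction with
  | H F ih =>
  by_cases h : ∀ f ∈ F, ∀ i ∈ inc f, w i ≤ ((F.filter fun g => i ∈ inc g).card : ℝ)
  · exact ⟨F, Finset.Subset.refl _, h, by simpa using Finset.sum_nonneg fun i _ => hw i⟩
  · push Not at h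
    obtain ⟨f, hf, i, hi, hlt⟩ := h
    set F₁ := F.filter fun g => i ∉ inc g with hF₁
    have hss : F₁ ⊂ F := (Finset.filter_ssubset).2 ⟨f, hf, by simpa using hi⟩
    obtain ⟨F', hF', h1, h2⟩ := ih F₁ hss
    refine ⟨F', hF'.trans hss.1, h1, ?_⟩
    have hcard : ((F.filter fun g => i ∈ inc g).card : ℝ) + F₁.card = F.card := by
      exact_mod_cast Finset.card_filter_add_card_filter_not (s := F) (fun g => i ∈ inc g)
    have hmem : i ∈ F.biUnion inc := Finset.mem_biUnion.2 ⟨f, hf, hi⟩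
    -- The class `i` is not met any more, so each class is charged at most once.
    have hsub : F₁.biUnion inc ⊆ (F.biUnion inc).erase i := by
      intro j hj
      obtain ⟨g, hg, hgj⟩ := Finset.mem_biUnion.1 hj
      refine Finset.mem_erase.2 ⟨?_, Finset.mem_biUnion.2 ⟨g, hss.1 hg, hgj⟩⟩
      rintro rfl
      exact (Finset.mem_filter.1 hg).2 hgj
    have hsum := Finset.sum_le_sum_of_subset_of_nonneg hsub (f := w) fun j _ _ => hw j
    have := Finset.add_sum_erase _ w hmem
    linarith

theorem exists_card_le_mul_card_fiber {α β : Type*} [Fintype β] [Nonempty β] [DecidableEq β]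
    (f : α → β) (s : Finset α) :
    ∃ b, s.card ≤ Fintype.card β * (s.filter fun a => f a = b).card := by
  obtain ⟨b, -, hb⟩ := Finset.exists_max_image (Finset.univ : Finset β)
    (fun b => (s.filter fun a => f a = b).card) Finset.univ_nonempty
  refine ⟨b, ?_⟩
  rw [Finset.card_eq_sum_card_fiberwise (f := f) (t := Finset.univ) (fun _ _ => Finset.mem_univ _)]
  simpa using Finset.sum_le_card_nsmul Finset.univ _ _ hb

/-- For some colouring of the vertices, a fraction of the members of a family of injections is
coloured in the prescribed way. -/
theorem exists_coloring {n r : ℕ} (hr : 0 < r) (F : Finset (Fin r → Fin n))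
    (hF : ∀ f ∈ F, Function.Injective f) : ∃ c : Fin n → Fin r,
      F.card ≤ r ^ r * (F.filter fun f => ∀ i, c (f i) = i).card := by
  classical
  have : Nonempty (Fin r) := ⟨⟨0, hr⟩⟩
  have hcol : ∀ f ∈ F, r ^ n ≤ r ^ r *
      ((Finset.univ : Finset (Fin n → Fin r)).filter fun c => ∀ i, c (f i) = i).card := by
    intro f hf
    have hinj := hF f hf
    -- Overwriting the colours on the image of `f` by the prescribed ones loses only `g ∘ f`, for
    -- which there are `r ^ r` possibilities.
    let Φ : (Fin n → Fin r) → (Fin r → Fin r) × (Fin n → Fin r) :=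
      fun g => (g ∘ f, Function.extend f id g)
    have h := Finset.card_le_card_of_injOn (s := Finset.univ)
      (t := (Finset.univ : Finset (Fin r → Fin r)) ×ˢ
        (Finset.univ : Finset (Fin n → Fin r)).filter fun c => ∀ i, c (f i) = i) Φ
      (fun g _ => by simp [Φ, hinj.extend_apply]) (fun g _ g' _ hgg => by
        funext v
        by_cases hv : ∃ w, f w = v
        · obtain ⟨w, rfl⟩ := hv
          exact congrFun (congrArg Prod.fst hgg) w
        · have := congrFun (congrArg Prod.snd hgg) v
          simpa only [Φ, Function.extend_apply' _ _ _ hv] using this)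
    simpa [Finset.card_product] using h
  by_contra hcon
  push Not at hcon
  have h1 : ∑ c : Fin n → Fin r, r ^ r * (F.filter fun f => ∀ i, c (f i) = i).card <
      ∑ _c : Fin n → Fin r, F.card :=
    Finset.sum_lt_sum_of_nonempty Finset.univ_nonempty fun c _ => hcon c
  rw [← Finset.mul_sum] at h1
  have h2 := Finset.sum_card_bipartiteAbove_eq_sum_card_bipartiteBelow
    (s := (Finset.univ : Finset (Fin n → Fin r))) (t := F) (fun c f => ∀ i, c (f i) = i)
  simp only [Finset.bipartiteAbove, Finset.bipartiteBelow] at h2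
  rw [h2, Finset.mul_sum] at h1
  have h3 := Finset.sum_le_sum hcol
  simp at h1 h3
  rw [mul_comm] at h3
  omega

/-! ### Edge-disjoint copies of `H`. -/

section Copies

variable {n r : ℕ}

/-- A family of copies of `H` in `G` such that no two members have an edge in common. -/
structure EdgeDisjointCopies (H : SimpleGraph (Fin r)) (G : SimpleGraph (Fin n))
    (F : Finset (Fin r → Fin n)) : Prop where
  injective : ∀ f ∈ F, Function.Injective f
  adj : ∀ f ∈ F, ∀ a b, H.Adj a b → G.Adj (f a) (f b)
  disjoint : ∀ f ∈ F, ∀ g ∈ F, ∀ a b a' b', H.Adj a b → H.Adj a' b' →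
    f a = g a' → f b = g b' → f = g

variable {H : SimpleGraph (Fin r)} {G : SimpleGraph (Fin n)} {F : Finset (Fin r → Fin n)}

theorem EdgeDisjointCopies.subset {F' : Finset (Fin r → Fin n)} (hF : EdgeDisjointCopies H G F)
    (h : F' ⊆ F) : EdgeDisjointCopies H G F' :=
  ⟨fun f hf => hF.injective f (h hf), fun f hf => hF.adj f (h hf),
    fun f hf g hg => hF.disjoint f (h hf) g (h hg)⟩

/-- If the edges of a maximum family are deleted, a remaining copy could be added to the family.
This needs `H` to have an edge; otherwise the copy would embed `H` in the edgeless graph. -/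
theorem exists_edgeDisjointCopies {ε : ℝ} (hfar : IsFar (freeFamily H) ε G)
    (hH : H.Free (⊥ : SimpleGraph (Fin n))) :
    ∃ F, EdgeDisjointCopies H G F ∧ ε * n ≤ (r ^ 2 * F.card : ℕ) := by
  classical
  obtain ⟨F, hF, hmax⟩ := Finset.exists_max_image
    (Finset.univ.filter fun F : Finset (Fin r → Fin n) => EdgeDisjointCopies H G F) Finset.card
    ⟨∅, by simpa using ⟨by simp, by simp, by simp⟩⟩
  replace hF : EdgeDisjointCopies H G F := by simpa using hF
  refine ⟨F, hF, ?_⟩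
  let E : Finset (Sym2 (Fin n)) :=
    ((F ×ˢ (Finset.univ : Finset (Fin r × Fin r))).filter fun x => H.Adj x.2.1 x.2.2).image
      fun x => s(x.1 x.2.1, x.1 x.2.2)
  have hE : ∀ f ∈ F, ∀ a b, H.Adj a b → s(f a, f b) ∈ E := fun f hf a b hab =>
    Finset.mem_image.2 ⟨(f, a, b), by simpa using ⟨hf, hab⟩, rfl⟩
  have hEcard : E.card ≤ r ^ 2 * F.card := by
    refine Finset.card_image_le.trans ((Finset.card_filter_le _ _).trans (le_of_eq ?_))
    rw [Finset.card_product]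
    simp [pow_two, mul_comm]
  have hfree : G.deleteEdges E ∈ freeFamily H n := by
    rintro ⟨φ⟩
    have hadj : ∀ a b, H.Adj a b → G.Adj (φ a) (φ b) ∧ s(φ a, φ b) ∉ E := fun a b hab => by
      have := φ.toHom.map_adj hab
      rw [SimpleGraph.deleteEdges_adj] at this
      exact_mod_cast this
    obtain ⟨a, b, hab⟩ : ∃ a b, H.Adj a b := by
      by_contra hcon
      push Not at hcon
      exact hH ⟨⟨⟨φ, fun {a b} hab => absurd hab (hcon a b)⟩, φ.injective⟩⟩
    have hnot : (φ : Fin r → Fin n) ∉ F := fun hmem => (hadj a b hab).2 (hE _ hmem a b hab)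
    have := hmax (insert (φ : Fin r → Fin n) F) (by
      refine Finset.mem_filter.2 ⟨Finset.mem_univ _, fun f hf => ?_, fun f hf => ?_,
        fun f hf g hg a b a' b' hab hab' h1 h2 => ?_⟩
      · rcases Finset.mem_insert.1 hf with rfl | hf
        · exact φ.injective
        · exact hF.injective f hf
      · rcases Finset.mem_insert.1 hf with rfl | hf
        · exact fun a b hab => (hadj a b hab).1
        · exact hF.adj f hf
      · rcases Finset.mem_insert.1 hf with rfl | hf <;> rcases Finset.mem_insert.1 hg with rfl | hg
        · rfl
        · exact absurd (h1 ▸ h2 ▸ hE g hg a' b' hab') (hadj a b hab).2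
        · exact absurd (h1 ▸ h2 ▸ hE f hf a b hab) (hadj a' b' hab').2
        · exact hF.disjoint f hf g hg a b a' b' hab hab' h1 h2)
    rw [Finset.card_insert_of_notMem hnot] at this
    omega
  refine (hfar _ hfree).trans ?_
  have hsub : symmDiff G.edgeSet (G.deleteEdges E).edgeSet ⊆ (E : Set (Sym2 (Fin n))) := by
    rw [SimpleGraph.edgeSet_deleteEdges]
    rintro e (⟨h1, h2⟩ | ⟨h1, h2⟩)
    · by_contra h
      exact h2 ⟨h1, h⟩
    · exact absurd h1.1 h2
  have := Set.ncard_le_ncard hsub E.finite_toSet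
  rw [Set.ncard_coe_finset] at this
  exact_mod_cast this.trans hEcard

variable {rk : Fin n → ℕ} {p D : ℕ}

/-- Only few members of a family of edge-disjoint copies have an edge between vertices of large
degree. -/
theorem EdgeDisjointCopies.exists_low (hF : EdgeDisjointCopies H G F)
    (hinj : Function.Injective rk)
    (hlow : ∀ v, ((nbrs G v).filter fun u => rk u < rk v).card ≤ p)
    (hsum : ∑ v, deg G v ≤ 2 * p * n) :
    ∃ F' ⊆ F, (∀ f ∈ F', ∀ a b, H.Adj a b → deg G (f a) ≤ D ∨ deg G (f b) ≤ D) ∧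
      D * F.card ≤ D * F'.card + 2 * p ^ 2 * n := by
  classical
  let Good : (Fin r → Fin n) → Prop := fun f =>
    ∀ a b, H.Adj a b → deg G (f a) ≤ D ∨ deg G (f b) ≤ D
  refine ⟨F.filter Good, Finset.filter_subset _ _, fun f hf => (Finset.mem_filter.1 hf).2, ?_⟩
  rw [← Finset.card_filter_add_card_filter_not Good (s := F), mul_add]
  refine Nat.add_le_add_left ?_ _
  set Hi : Finset (Fin n) := Finset.univ.filter fun v => D < deg G v with hHi
  have hHicard : D * Hi.card ≤ 2 * p * n := by
    refine le_trans ?_ hsum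
    refine le_trans ?_ (Finset.sum_le_sum_of_subset (Finset.subset_univ Hi))
    rw [mul_comm, ← smul_eq_mul]
    exact Finset.card_nsmul_le_sum _ _ _ fun v hv => (Finset.mem_filter.1 hv).2.le
  have hbad : ∀ f ∈ F.filter fun f => ¬ Good f, ∃ e : Fin r × Fin r, H.Adj e.1 e.2 ∧
      D < deg G (f e.1) ∧ rk (f e.2) < rk (f e.1) := by
    intro f hf
    obtain ⟨hf, hfG⟩ := Finset.mem_filter.1 hf
    simp only [Good] at hfG
    push Not at hfG
    obtain ⟨a, b, hab, ha, hb⟩ := hfG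
    have hne : rk (f a) ≠ rk (f b) := hinj.ne ((hF.injective f hf).ne hab.ne)
    rcases lt_or_gt_of_ne hne with h | h
    · exact ⟨(b, a), hab.symm, hb, h⟩
    · exact ⟨(a, b), hab, ha, h⟩
  by_cases hr : Nonempty (Fin r × Fin r)
  swap
  · have : F.filter (fun f => ¬ Good f) = ∅ := by
      refine Finset.eq_empty_of_forall_notMem fun f hf => ?_
      obtain ⟨e, -⟩ := hbad f hf
      exact hr ⟨e⟩
    rw [this]
    simp
  choose! e he1 he2 he3 using hbad
  -- Each bad copy is charged to an edge from a vertex of degree above `D` to a smaller neighbour,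
  -- injectively by edge-disjointness.
  have hcard : (F.filter fun f => ¬ Good f).card ≤ Hi.card * p := by
    have h1 := Finset.card_le_card_of_injOn (s := F.filter fun f => ¬ Good f)
      (t := Hi.sigma fun v => (nbrs G v).filter fun u => rk u < rk v)
      (fun f => ⟨f (e f).1, f (e f).2⟩) (fun f hf => by
        have hf' := (Finset.mem_filter.1 hf).1
        simp only [Finset.coe_sigma, Set.mem_sigma_iff, Finset.mem_coe, Finset.mem_filter, hHi,
          Finset.mem_univ, true_and, mem_nbrs]
        exact ⟨he2 f hf, hF.adj f hf' _ _ (he1 f hf), he3 f hf⟩) (fun f hf g hg hfg => by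
        simp only [Sigma.mk.injEq, heq_eq_eq] at hfg
        exact hF.disjoint f (Finset.mem_filter.1 hf).1 g (Finset.mem_filter.1 hg).1 _ _ _ _
          (he1 f hf) (he1 g hg) hfg.1 hfg.2)
    refine h1.trans ?_
    rw [Finset.card_sigma, ← smul_eq_mul]
    exact Finset.sum_le_card_nsmul _ _ _ fun v _ => hlow v
  calc D * _ ≤ D * (Hi.card * p) := Nat.mul_le_mul_left _ hcard
    _ = (D * Hi.card) * p := by ring
    _ ≤ (2 * p * n) * p := Nat.mul_le_mul_right _ hHicard
    _ = 2 * p ^ 2 * n := by ring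

/-- A family of edge-disjoint copies contains a large subfamily which is coloured and, after
renaming the vertices of `H`, sorted by a given key. -/
theorem EdgeDisjointCopies.exists_sorted_colored (hF : EdgeDisjointCopies H G F) (hr : 0 < r)
    {key : Fin n → ℕ} (hkey : Function.Injective key) :
    ∃ (σ : Equiv.Perm (Fin r)) (c : Fin n → Fin r) (F' : Finset (Fin r → Fin n)),
      EdgeDisjointCopies (H.comap σ) G F' ∧ (∀ f ∈ F', f ∘ σ.symm ∈ F) ∧
      (∀ f ∈ F', ∀ i, c (f i) = i) ∧ (∀ f ∈ F', StrictMono (key ∘ f)) ∧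
      F.card ≤ r.factorial * r ^ r * F'.card := by
  classical
  obtain ⟨σ, hσ⟩ := exists_card_le_mul_card_fiber
    (fun f : Fin r → Fin n => Tuple.sort (key ∘ f)) F
  set F₁ := (F.filter fun f => Tuple.sort (key ∘ f) = σ) with hF₁
  let F₂ := F₁.image fun f => f ∘ σ
  have hback : ∀ f ∈ F₂, f ∘ σ.symm ∈ F₁ := by
    intro f hf
    obtain ⟨g, hg, rfl⟩ := Finset.mem_image.1 hf
    simpa [Function.comp_assoc] using hg
  have hcard : F₂.card = F₁.card := Finset.card_image_of_injective _
    σ.surjective.injective_comp_right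
  have hinj : ∀ f ∈ F₂, Function.Injective f := by
    intro f hf
    obtain ⟨g, hg, rfl⟩ := Finset.mem_image.1 hf
    exact (hF.injective g (Finset.mem_filter.1 hg).1).comp σ.injective
  have hcopies : EdgeDisjointCopies (H.comap σ) G F₂ := by
    refine ⟨hinj, fun f hf a b hab => ?_, fun f hf g hg a b a' b' hab hab' h1 h2 => ?_⟩
    · obtain ⟨g, hg, rfl⟩ := Finset.mem_image.1 hf
      exact hF.adj g (Finset.mem_filter.1 hg).1 _ _ hab
    · obtain ⟨f', hf', rfl⟩ := Finset.mem_image.1 hf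
      obtain ⟨g', hg', rfl⟩ := Finset.mem_image.1 hg
      rw [hF.disjoint f' (Finset.mem_filter.1 hf').1 g' (Finset.mem_filter.1 hg').1 _ _ _ _ hab hab'
        h1 h2]
  obtain ⟨c, hc⟩ := exists_coloring hr F₂ hinj
  refine ⟨σ, c, F₂.filter fun f => ∀ i, c (f i) = i, hcopies.subset (Finset.filter_subset _ _),
    fun f hf => (Finset.mem_filter.1 (hback f (Finset.mem_filter.1 hf).1)).1,
    fun f hf => (Finset.mem_filter.1 hf).2, fun f hf => ?_, ?_⟩
  · obtain ⟨g, hg, rfl⟩ := Finset.mem_image.1 (Finset.mem_filter.1 hf).1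
    obtain ⟨hg, hgσ⟩ := Finset.mem_filter.1 hg
    refine Monotone.strictMono_of_injective ?_
      (hkey.comp (hinj _ (Finset.mem_filter.1 hf).1))
    rw [← hgσ]
    exact Tuple.monotone_sort (key ∘ g)
  · rw [Fintype.card_perm, Fintype.card_fin] at hσ
    rw [mul_assoc]
    exact hσ.trans (Nat.mul_le_mul_left _ (hcard ▸ hc))

end Copies

/-! ### Fronts in sorted copies, and explorability. -/

variable {n r : ℕ} {H : SimpleGraph (Fin r)} {G : SimpleGraph (Fin n)}
  {F : Finset (Fin r → Fin n)} {rk : Fin n → ℕ} {p D : ℕ}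

/-- A key sorting vertices of degree above `D` before the others, and by `rk` otherwise. -/
noncomputable def sortKey (G : SimpleGraph (Fin n)) (rk : Fin n → ℕ) (D : ℕ) (v : Fin n) : ℕ :=
  if deg G v ≤ D then (∑ u, rk u) + 1 + rk v else rk v

theorem sortKey_injective (hinj : Function.Injective rk) :
    Function.Injective (sortKey G rk D) := by
  intro u v h
  have hle : ∀ v, rk v ≤ ∑ u, rk u := fun v =>
    Finset.single_le_sum (f := rk) (by simp) (Finset.mem_univ v)
  have := hle u
  have := hle v
  refine hinj ?_
  unfold sortKey at h
  split_ifs at h <;> omega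

theorem lt_of_sortKey_lt {u v : Fin n} (h : sortKey G rk D u < sortKey G rk D v)
    (hv : D < deg G v) : D < deg G u ∧ rk u < rk v := by
  have hle : rk v ≤ ∑ u, rk u := Finset.single_le_sum (f := rk) (by simp) (Finset.mem_univ v)
  unfold sortKey at h
  split_ifs at h <;> omega

/-- In a sorted copy, the front of a vertex of large degree is among its targets. -/
theorem mem_targets_of_mem_front {f : Fin r → Fin n}
    (hadj : ∀ a b, H.Adj a b → G.Adj (f a) (f b)) (hmono : StrictMono (sortKey G rk D ∘ f))
    {a s : Fin r} (ha : D < deg G (f a)) (hs : s ∈ front H a) :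
    f s ∈ targets G {w | deg G w ≤ D ∨ rk (f a) ≤ rk w} r (f a) := by
  classical
  obtain ⟨hsa, w, hr, hw⟩ := hs
  have hs' := lt_of_sortKey_lt (hmono hsa) ha
  obtain ⟨q, hq⟩ := hr.exists_isPath
  let φ : upper H a →g G := ⟨f, fun h => hadj _ _ h.1⟩
  refine mem_targets.2 ⟨?_, (q.map φ).concat (hadj w s hw), ?_, fun v hv => ?_⟩
  · intro h
    rcases h with h | h <;> omega
  -- A path in `H` has fewer than `r` edges, which leaves room for the last edge to `s`.
  · have := hq.length_lt
    rw [Fintype.card_fin] at this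
    simpa [SimpleGraph.Walk.length_concat] using this
  · rw [SimpleGraph.Walk.support_concat, SimpleGraph.Walk.support_map] at hv
    rcases (by simpa using hv : (∃ i ∈ q.support, φ i = v) ∨ v = f s) with ⟨i, hi, rfl⟩ | rfl
    · right
      have hai : a ≤ i := le_of_upper_reachable ⟨q.takeUntil i hi⟩ le_rfl
      by_cases hd : deg G (f i) ≤ D
      · exact Or.inl hd
      · refine Or.inr ?_
        rcases eq_or_lt_of_le hai with rfl | hai
        · exact le_rfl
        · exact (lt_of_sortKey_lt (hmono hai) (not_le.1 hd)).2.le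
    · exact Or.inl rfl

open Classical in
/-- The restriction of `f` to `a` and its front. -/
noncomputable def frontMap (H : SimpleGraph (Fin r)) (a : Fin r) (f : Fin r → Fin n) :
    Fin r → Option (Fin n) :=
  fun s => if s = a ∨ s ∈ front H a then some (f s) else none

theorem frontMap_self (a : Fin r) (f : Fin r → Fin n) : frontMap H a f a = some (f a) := by
  simp [frontMap]

theorem eq_of_frontMap_eq {a : Fin r} {f g : Fin r → Fin n}
    (h : frontMap H a f = frontMap H a g) {s : Fin r} (hs : s = a ∨ s ∈ front H a) :
    f s = g s := by
  have := congrFun h s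
  simpa [frontMap, hs] using this

open Classical in
/-- There are few restrictions of members of a sorted family of copies to a vertex of large degree
and its front, if the image of this vertex is fixed. -/
theorem card_frontMap_le (hF : EdgeDisjointCopies H G F)
    (hmono : ∀ f ∈ F, StrictMono (sortKey G rk D ∘ f)) {K : ℕ}
    (hK : ∀ x u, (targets G {w | deg G w ≤ D ∨ rk x ≤ rk w} r u).card ≤ K) (a : Fin r) (x : Fin n)
    (hx : D < deg G x) :
    ((F.filter fun f => f a = x).image (frontMap H a)).card ≤ (K + 2) ^ r := by
  let T : Finset (Option (Fin n)) := insert none (insert (some x)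
    ((targets G {w | deg G w ≤ D ∨ rk x ≤ rk w} r x).image some))
  have hT : T.card ≤ K + 2 := by
    refine (Finset.card_insert_le _ _).trans (Nat.succ_le_succ ?_)
    refine (Finset.card_insert_le _ _).trans (Nat.succ_le_succ ?_)
    exact Finset.card_image_le.trans (hK x x)
  refine (Finset.card_le_card (t := Fintype.piFinset fun _ => T) fun κ hκ => ?_).trans ?_
  · obtain ⟨f, hf, rfl⟩ := Finset.mem_image.1 hκ
    obtain ⟨hfF, rfl⟩ := Finset.mem_filter.1 hf
    refine Fintype.mem_piFinset.2 fun s => ?_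
    unfold frontMap
    split_ifs with h
    · rcases h with rfl | h
      · simp [T]
      · have := mem_targets_of_mem_front (hF.adj f hfF) (hmono f hfF) hx h
        simp only [T, Finset.mem_insert, Finset.mem_image]
        exact Or.inr (Or.inr ⟨_, this, rfl⟩)
    · simp [T]
  · rw [Fintype.card_piFinset]
    simpa using Nat.pow_le_pow_left hT r

/-- A sorted family of copies can be pruned such that each vertex of large degree of a copy is
contained in many copies with the same front. -/
theorem exists_pruned_copies (hF : EdgeDisjointCopies H G F)
    (hmono : ∀ f ∈ F, StrictMono (sortKey G rk D ∘ f)) {K : ℕ}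
    (hK : ∀ x u, (targets G {w | deg G w ≤ D ∨ rk x ≤ rk w} r u).card ≤ K)
    (hsum : ∑ v, deg G v ≤ 2 * p * n) {θ : ℝ} (hθ : 0 ≤ θ) : ∃ F' ⊆ F,
      (∀ f ∈ F', ∀ a, D < deg G (f a) → ∃ C ⊆ F', f ∈ C ∧ θ * deg G (f a) ≤ C.card ∧
        ∀ g ∈ C, g a = f a ∧ ∀ s ∈ front H a, g s = f s) ∧
      (F.card : ℝ) - F'.card ≤ r * ((K + 2) ^ r * (θ * (2 * p * n))) := by
  classical
  -- A class consists of the copies with a given restriction to `a` and its front. It must have `θ *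
  -- deg G x` members, where `x` is the image of `a`; nothing is asked if `x` has small degree.
  let W : Fin r × Option (Fin n) → ℝ := fun j =>
    j.2.elim 0 fun x => if D < deg G x then θ * deg G x else 0
  have hW : ∀ j, 0 ≤ W j := by
    rintro ⟨a, _ | x⟩
    · exact le_rfl
    · simp only [W, Option.elim]
      split_ifs <;> positivity
  let g : Fin r × (Fin r → Option (Fin n)) → Fin r × Option (Fin n) := fun i => (i.1, i.2 i.1)
  let inc : (Fin r → Fin n) → Finset (Fin r × (Fin r → Option (Fin n))) :=
    fun f => Finset.univ.image fun a => (a, frontMap H a f)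
  have hinc : ∀ f a κ, (a, κ) ∈ inc f ↔ frontMap H a f = κ := by
    intro f a κ
    simp only [inc, Finset.mem_image, Finset.mem_univ, true_and, Prod.mk.injEq]
    exact ⟨by rintro ⟨_, rfl, h⟩; exact h, fun h => ⟨a, rfl, h⟩⟩
  obtain ⟨F', hF', h1, h2⟩ := exists_pruned inc (fun i => W (g i)) (fun i => hW _) F
  refine ⟨F', hF', fun f hf a ha => ?_, h2.trans ?_⟩
  · refine ⟨F'.filter fun g => (a, frontMap H a f) ∈ inc g, Finset.filter_subset _ _,
      Finset.mem_filter.2 ⟨hf, (hinc _ _ _).2 rfl⟩, ?_, fun φ hφ => ?_⟩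
    · have := h1 f hf (a, frontMap H a f) ((hinc _ _ _).2 rfl)
      simpa [W, g, frontMap_self, ha] using this
    · have := (hinc _ _ _).1 (Finset.mem_filter.1 hφ).2
      exact ⟨eq_of_frontMap_eq this (Or.inl rfl), fun s hs => eq_of_frontMap_eq this (Or.inr hs)⟩
  · rw [← Finset.sum_fiberwise_of_maps_to (t := Finset.univ) (g := g)
      (fun _ _ => Finset.mem_univ _)]
    have hfib : ∀ j : Fin r × Option (Fin n),
        ∑ i ∈ (F.biUnion inc).filter (fun i => g i = j), W (g i) ≤ (K + 2) ^ r * W j := by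
      intro j
      rw [Finset.sum_congr rfl (g := fun _ => W j) fun i hi => by rw [(Finset.mem_filter.1 hi).2],
        Finset.sum_const, nsmul_eq_mul]
      obtain ⟨a, _ | x⟩ := j
      · simp [W]
      by_cases hx : D < deg G x
      swap
      · simp [W, hx]
      refine mul_le_mul_of_nonneg_right ?_ (hW _)
      have := Finset.card_le_card_of_injOn
        (s := (F.biUnion inc).filter (fun i => g i = (a, some x)))
        (t := (F.filter fun f => f a = x).image (frontMap H a)) Prod.snd (fun i hi => by
          obtain ⟨hi, hgi⟩ := Finset.mem_filter.1 hi
          obtain ⟨f, hf, hfi⟩ := Finset.mem_biUnion.1 hi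
          obtain ⟨b, κ⟩ := i
          obtain rfl := (hinc _ _ _).1 hfi
          simp only [g, Prod.mk.injEq] at hgi
          obtain ⟨rfl, hgi⟩ := hgi
          rw [frontMap_self] at hgi
          exact Finset.mem_coe.2 (Finset.mem_image.2
            ⟨f, Finset.mem_filter.2 ⟨hf, Option.some.inj hgi⟩, rfl⟩)) (fun i hi i' hi' hii => by
          have h1 : i.1 = a := congrArg Prod.fst (Finset.mem_filter.1 hi).2
          have h2 : i'.1 = a := congrArg Prod.fst (Finset.mem_filter.1 hi').2
          exact Prod.ext (h1.trans h2.symm) hii)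
      exact_mod_cast this.trans (card_frontMap_le hF hmono hK a x hx)
    refine (Finset.sum_le_sum fun j _ => hfib j).trans ?_
    rw [← Finset.mul_sum, Fintype.sum_prod_type]
    have hWs : ∀ a : Fin r, ∑ o, W (a, o) ≤ θ * (2 * p * n) := by
      intro a
      rw [Fintype.sum_option]
      have : ∑ x, W (a, some x) ≤ ∑ x, θ * deg G x := Finset.sum_le_sum fun x _ => by
        simp only [W, Option.elim]
        split_ifs
        · exact le_rfl
        · positivity
      rw [← Finset.mul_sum] at this
      have h3 : (∑ x, (deg G x : ℝ)) ≤ 2 * p * n := by exact_mod_cast hsum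
      have h4 := mul_le_mul_of_nonneg_left h3 hθ
      simp only [W, Option.elim, zero_add] at this ⊢
      linarith
    have := Finset.sum_le_card_nsmul Finset.univ _ _ fun a (_ : a ∈ Finset.univ) => hWs a
    rw [Finset.card_univ, Fintype.card_fin, nsmul_eq_mul] at this
    calc _ ≤ ((K : ℝ) + 2) ^ r * (r * (θ * (2 * p * n))) :=
          mul_le_mul_of_nonneg_left this (by positivity)
      _ = _ := by ring

/-- Pruned families of edge-disjoint coloured copies are explorable. -/
theorem explorable_of_pruned (hF : EdgeDisjointCopies H G F) (hD : 0 < D) {c : Fin n → Fin r}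
    (hc : ∀ f ∈ F, ∀ i, c (f i) = i)
    (hlow : ∀ f ∈ F, ∀ a b, H.Adj a b → deg G (f a) ≤ D ∨ deg G (f b) ≤ D) {θ δ η : ℝ}
    (hhigh : ∀ f ∈ F, ∀ a, D < deg G (f a) → ∃ C ⊆ F, f ∈ C ∧ θ * deg G (f a) ≤ C.card ∧
        ∀ g ∈ C, g a = f a ∧ ∀ s ∈ front H a, g s = f s)
    (hδ : δ * n ≤ F.card) (hη : 0 ≤ η) (hηθ : η ≤ θ) (hηD : η * D ≤ 1) (hηδ : η * (2 * D) ≤ δ) :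
    Explorable H G η c F := by
  classical
  refine ⟨hc, fun f hf a b hab => ?_, fun a b hab => ?_⟩
  · rcases le_or_gt (deg G (f a)) D with hd | hd
    · refine ⟨{f b}, by simp, ?_, fun u hu => ?_⟩
      · refine le_trans ?_ (hηD.trans (by simp))
        exact mul_le_mul_of_nonneg_left (by exact_mod_cast hd) hη
      · obtain rfl := Finset.mem_singleton.1 hu
        exact ⟨hF.adj f hf a b hab, f, hf, rfl, rfl, fun _ _ => rfl⟩
    · obtain ⟨C, hCF, hfC, hC, hCa⟩ := hhigh f hf a hd
      refine ⟨C.image fun g => g b, ⟨f b, Finset.mem_image_of_mem _ hfC⟩, ?_, fun u hu => ?_⟩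
      -- Members of `C` share the image of `a`, so by edge-disjointness their images of `b` are
      -- distinct.
      · rw [Finset.card_image_of_injOn fun g hg g' hg' hgg => hF.disjoint g (hCF hg) g' (hCF hg')
          a b a b hab hab ((hCa g hg).1.trans (hCa g' hg').1.symm) hgg]
        exact (mul_le_mul_of_nonneg_right hηθ (Nat.cast_nonneg _)).trans hC
      · obtain ⟨g, hg, rfl⟩ := Finset.mem_image.1 hu
        have hga := hCa g hg
        exact ⟨hga.1 ▸ hF.adj g (hCF hg) a b hab, g, hCF hg, rfl, hga⟩
  -- Some end of the edge has small degree in at least half of the copies, and a vertex of small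
  -- degree serves as this end in at most `D` of them.
  · have key : ∀ a b, H.Adj a b →
        F.card ≤ 2 * (F.filter fun f => deg G (f a) ≤ D).card →
        ∃ A : Finset (Fin n), η * n ≤ A.card ∧
          ∀ v ∈ A, ∃ φ ∈ (F : Set (Fin r → Fin n)), φ a = v := by
      intro a b hab hcard
      refine ⟨(F.filter fun f => deg G (f a) ≤ D).image fun f => f a, ?_, fun v hv => ?_⟩
      · have h := Finset.card_le_mul_card_image (f := fun f : Fin r → Fin n => f a)
          (F.filter fun f => deg G (f a) ≤ D) D (fun v hv => by
            obtain ⟨f, hf, rfl⟩ := Finset.mem_image.1 hv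
            refine le_trans ?_ (Finset.mem_filter.1 hf).2
            refine Finset.card_le_card_of_injOn (fun g => g b) (fun g hg => ?_)
              fun g hg g' hg' hgg => ?_
            · obtain ⟨hg, hga⟩ := Finset.mem_filter.1 hg
              exact Finset.mem_coe.2 (mem_nbrs.2
                (hga ▸ hF.adj g (Finset.mem_filter.1 hg).1 a b hab))
            · obtain ⟨hg, hga⟩ := Finset.mem_filter.1 hg
              obtain ⟨hg', hga'⟩ := Finset.mem_filter.1 hg'
              exact hF.disjoint g (Finset.mem_filter.1 hg).1 g' (Finset.mem_filter.1 hg').1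
                a b a b hab hab (hga.trans hga'.symm) hgg)
        set A := (F.filter fun f => deg G (f a) ≤ D).image fun f => f a
        have h2 : F.card ≤ 2 * D * A.card := by nlinarith
        have h3 : (F.card : ℝ) ≤ 2 * D * A.card := by exact_mod_cast h2
        have h4 := mul_le_mul_of_nonneg_right hηδ (Nat.cast_nonneg (α := ℝ) n)
        have hD' : (0 : ℝ) < 2 * D := by positivity
        refine le_of_mul_le_mul_left ?_ hD'
        nlinarith
      · obtain ⟨f, hf, rfl⟩ := Finset.mem_image.1 hv
        exact ⟨f, (Finset.mem_filter.1 hf).1, rfl⟩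
    have hunion : F.card ≤ (F.filter fun f => deg G (f a) ≤ D).card +
        (F.filter fun f => deg G (f b) ≤ D).card := by
      refine le_trans (Finset.card_le_card fun f hf => ?_) (Finset.card_union_le _ _)
      rcases hlow f hf a b hab with h | h
      · exact Finset.mem_union_left _ (Finset.mem_filter.2 ⟨hf, h⟩)
      · exact Finset.mem_union_right _ (Finset.mem_filter.2 ⟨hf, h⟩)
    rcases le_total (F.filter fun f => deg G (f b) ≤ D).card
      (F.filter fun f => deg G (f a) ≤ D).card with h | h
    · exact ⟨a, Or.inl rfl, key a b hab (by omega)⟩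
    · exact ⟨b, Or.inr rfl, key b a hab.symm (by omega)⟩

/-! ### Choice of the constants and conclusion. -/

/-- In a graph of bounded admissibility which is far from being `H`-free there is an explorable
family, up to a renaming of the vertices of `H`. -/
theorem exists_explorable (r p : ℕ) {ε : ℝ} (hε : 0 < ε) : ∃ η : ℝ, 0 < η ∧ η ≤ 1 ∧
    ∀ (H : SimpleGraph (Fin r)) (n : ℕ) (G : SimpleGraph (Fin n)), 0 < n →
      admissibility G r ≤ (p : ℕ∞) → IsFar (freeFamily H) ε G →
      H.Free (⊥ : SimpleGraph (Fin n)) →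
      ∃ (σ : Equiv.Perm (Fin r)) (c : Fin n → Fin r) (F : Set (Fin r → Fin n)),
        Explorable (H.comap σ) G η c F ∧ F.Nonempty := by
  -- With this `D`, edges between vertices of large degree spoil at most half of the guaranteed `ε *
  -- n / r ^ 2` copies.
  obtain ⟨D, hD⟩ := exists_nat_ge (4 * p ^ 2 * r ^ 2 / ε + 1 : ℝ)
  have hD0 : 0 < D := by
    have : (0 : ℝ) < D := lt_of_lt_of_le (by positivity) hD
    exact_mod_cast this
  let K : ℕ := D + p * r
  -- Sorting and colouring leave at least `δ * n` copies. Pruning costs at most `θ * B * n`, which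
  -- is half of that.
  let B : ℝ := r * (((K ^ r : ℕ) + 2 : ℝ) ^ r * (2 * p)) + 1
  let δ : ℝ := ε / (2 * r ^ 2 * (r.factorial * r ^ r) + 1)
  let θ : ℝ := δ / (2 * B)
  have hB : 0 < B := by positivity
  have hδ : 0 < δ := by positivity
  have hθ : 0 < θ := by positivity
  have hDR : (0 : ℝ) < D := by exact_mod_cast hD0
  refine ⟨min (min θ (1 / D)) (δ / (4 * D)), by positivity, ?_, ?_⟩
  · refine (min_le_left _ _).trans ((min_le_right _ _).trans ?_)
    rw [div_le_one hDR]
    exact_mod_cast hD0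
  intro H n G hn hadm hfar hfree
  have hr : 0 < r := by
    rcases Nat.eq_zero_or_pos r with rfl | h
    · exact absurd ⟨⟨⟨fun i => i.elim0, fun {a} => a.elim0⟩, fun i => i.elim0⟩⟩ hfree
    · exact h
  have hnR : (0 : ℝ) < n := by exact_mod_cast hn
  have hrR : (0 : ℝ) < r := by exact_mod_cast hr
  obtain ⟨L, rk, hinj, hrk, hp⟩ := exists_order_of_admissibility_le hadm
  have hlower := card_lower_nbrs_le hr hrk hp
  have hsum := sum_deg_le hinj hlower
  obtain ⟨F₀, hF₀, hF₀card⟩ := exists_edgeDisjointCopies hfar hfree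
  obtain ⟨F₁, hF₁, hF₁low, hF₁card⟩ := hF₀.exists_low (D := D) hinj hlower hsum
  obtain ⟨σ, c, F₂, hF₂, hF₂F, hc, hmono, hF₂card⟩ :=
    (hF₀.subset hF₁).exists_sorted_colored hr (sortKey_injective (G := G) (D := D) hinj)
  have hlow₂ : ∀ f ∈ F₂, ∀ a b, (H.comap σ).Adj a b → deg G (f a) ≤ D ∨ deg G (f b) ≤ D := by
    intro f hf a b hab
    simpa using hF₁low _ (hF₂F f hf) _ _ hab
  have hK : ∀ x u, (targets G {w | deg G w ≤ D ∨ rk x ≤ rk w} r u).card ≤ K ^ r := fun x u =>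
    card_targets_le hrk hp (by omega) (by omega) (by omega) x r le_rfl u
  have hbig : δ * n ≤ F₂.card := by
    have h0 : ε * n ≤ r ^ 2 * F₀.card := by exact_mod_cast hF₀card
    have h1 : (D : ℝ) * F₀.card ≤ D * F₁.card + 2 * p ^ 2 * n := by exact_mod_cast hF₁card
    have h2 : (F₁.card : ℝ) ≤ r.factorial * r ^ r * F₂.card := by exact_mod_cast hF₂card
    have h3 : 4 * (p : ℝ) ^ 2 * r ^ 2 ≤ ε * D := by
      have : 4 * p ^ 2 * r ^ 2 / ε ≤ (D : ℝ) := by linarith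
      rw [div_le_iff₀ hε] at this
      linarith
    have h4 : ε * n ≤ 2 * r ^ 2 * F₁.card := by
      refine le_of_mul_le_mul_left ?_ hDR
      have h5 := mul_le_mul_of_nonneg_left h0 hDR.le
      have h6 := mul_le_mul_of_nonneg_left h1 (sq_nonneg (r : ℝ))
      have h7 := mul_le_mul_of_nonneg_right h3 hnR.le
      nlinarith
    have h5 : ε * n ≤ 2 * r ^ 2 * (r.factorial * r ^ r * F₂.card) :=
      h4.trans (mul_le_mul_of_nonneg_left h2 (by positivity))
    rw [div_mul_eq_mul_div, div_le_iff₀ (by positivity)]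
    nlinarith [Nat.cast_nonneg (α := ℝ) F₂.card]
  obtain ⟨F₃, hF₃, hhigh, hF₃card⟩ := exists_pruned_copies hF₂ hmono hK hsum hθ.le
  have hF₃big : δ / 2 * n ≤ F₃.card := by
    have h1 : r * (((K ^ r : ℕ) + 2 : ℝ) ^ r * (θ * (2 * p * n))) ≤ θ * B * n := by
      have : θ * B * n = r * (((K ^ r : ℕ) + 2 : ℝ) ^ r * (θ * (2 * p * n))) + θ * n := by
        simp only [B]; ring
      rw [this]
      have : 0 ≤ θ * n := by positivity
      linarith
    have h2 : θ * B = δ / 2 := by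
      simp only [θ]; field_simp
    rw [h2] at h1
    linarith
  refine ⟨σ, c, F₃, explorable_of_pruned (hF₂.subset hF₃) hD0 (fun f hf => hc f (hF₃ hf))
    (fun f hf => hlow₂ f (hF₃ hf)) hhigh hF₃big (by positivity)
    ((min_le_left _ _).trans (min_le_left _ _)) ?_ ?_, ?_⟩
  · refine (mul_le_mul_of_nonneg_right ((min_le_left _ _).trans (min_le_right _ _)) hDR.le).trans ?_
    rw [one_div_mul_cancel hDR.ne']
  · refine (mul_le_mul_of_nonneg_right (min_le_right _ _) (by positivity)).trans (le_of_eq ?_)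
    field_simp
    norm_num
  · have : (0 : ℝ) < F₃.card := lt_of_lt_of_le (by positivity) hF₃big
    have : 0 < F₃.card := by exact_mod_cast this
    exact Finset.card_pos.1 this

theorem isTestable_congr {W : Type*} {r : ℕ} {H : SimpleGraph W} {H' : SimpleGraph (Fin r)}
    (e : H ≃g H') {F : GraphFamily} {q : ℝ → ℕ} (h : IsTestable (freeFamily H') F q) :
    IsTestable (freeFamily H) F q := by
  have : freeFamily H = freeFamily H' :=
    funext fun n => Set.ext fun G => SimpleGraph.free_congr_left e
  rwa [this]

theorem exists_query_bound (r p : ℕ) {ε : ℝ} (hε : 0 < ε) : ∃ q : ℕ, ∀ (H : SimpleGraph (Fin r))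
    (m : ℕ), ∃ T : Algorithm (m + 1), T.maxQueries ≤ q ∧
      ∀ G ∈ admissibleFamily p r (m + 1), (G ∈ freeFamily H (m + 1) → T.run G true = 1) ∧
        (IsFar (freeFamily H) ε G → 2 / 3 ≤ T.run G false) := by
  classical
  obtain ⟨η, hη, hη1, hex⟩ := exists_explorable r p hε
  choose t₀ ht₀ using fun H : SimpleGraph (Fin r) => exists_attains_isContained H
  -- The renaming of `H` depends on the unknown `G`, so `t` has to serve all graphs on `Fin r`; this
  -- also makes the bound independent of `H`.
  let t : ℕ := ∑ H, t₀ H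
  have ht : ∀ H, t₀ H ≤ t := fun H =>
    Finset.single_le_sum (f := t₀) (by simp) (Finset.mem_univ H)
  let γ : ℝ := (η / (t + 1 : ℕ)) ^ t
  have hγ : 0 < γ := by positivity
  obtain ⟨N, hN⟩ := exists_pow_lt_of_lt_one (show (0 : ℝ) < 1 / 3 by norm_num)
    (show 1 - γ < 1 by linarith)
  refine ⟨N * t, fun H m => ⟨tester H m t N, maxQueries_tester t N, fun G hG =>
    ⟨fun hfree => ?_, fun hfar => ?_⟩⟩⟩
  · have := acc_tester_of_free (m := m) hfree t N
    rwa [Algorithm.acc, ENNReal.toReal_eq_one_iff] at this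
  · have hatt : Attains G η (fun st => H.IsContained (logGraph st)) t [] := by
      by_cases hbot : H.Free (⊥ : SimpleGraph (Fin (m + 1)))
      · obtain ⟨σ, c, F, hF, hne⟩ := hex H (m + 1) G (Nat.succ_pos _) hG hfar hbot
        refine ((ht₀ (H.comap σ) G η c F hF hne).mono (ht _)).weaken fun st _ h => ?_
        exact (SimpleGraph.isContained_congr_left (SimpleGraph.Iso.comap σ H)).1 h
      -- Here `H` embeds in the edgeless graph, so already the empty log contains it.
      · exact Attains.of_prop ((not_not.1 hbot).trans (SimpleGraph.IsContained.of_le bot_le))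
    have h1 := acc_tester_le (N := N) hη.le hη1 t hatt
    have h2 := Algorithm.run_false_eq (G := G) (tester H m t N)
    have h3 : (2 / 3 : ℝ) ≤ ((tester H m t N).run G false).toReal := by
      rw [h2]
      linarith
    rw [← ENNReal.ofReal_le_iff_le_toReal (PMF.apply_ne_top _ _)] at h3
    refine le_trans (le_of_eq ?_) h3
    rw [ENNReal.ofReal_div_of_pos (by norm_num)]
    simp

end GraphTesting

theorem theorem2 :
    ∃ q : ℝ → ℕ → ℕ → ℕ, ∀ (W : Type*) [Fintype W] (H : SimpleGraph W) (p : ℕ), 2 ≤ p →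
      GraphTesting.IsTestable (GraphTesting.freeFamily H)
        (GraphTesting.admissibleFamily p (Fintype.card W))
        (fun ε => q ε p (Fintype.card W)) := by
  classical
  have hq : ∀ (ε : ℝ) (p r : ℕ), ∃ q : ℕ, 0 < ε → ∀ (H : SimpleGraph (Fin r)) (m : ℕ),
      ∃ T : GraphTesting.Algorithm (m + 1), T.maxQueries ≤ q ∧
        ∀ G ∈ GraphTesting.admissibleFamily p r (m + 1),
          (G ∈ GraphTesting.freeFamily H (m + 1) → T.run G true = 1) ∧
          (GraphTesting.IsFar (GraphTesting.freeFamily H) ε G → 2 / 3 ≤ T.run G false) := by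
    intro ε p r
    by_cases hε : 0 < ε
    · obtain ⟨q, hq⟩ := GraphTesting.exists_query_bound r p hε
      exact ⟨q, fun _ => hq⟩
    · exact ⟨0, fun h => absurd h hε⟩
  choose q hq using hq
  refine ⟨q, fun W _ H p _ => ?_⟩
  let H' : SimpleGraph (Fin (Fintype.card W)) := H.map (Fintype.equivFin W).toEmbedding
  refine GraphTesting.isTestable_congr (H' := H') (SimpleGraph.Iso.map (Fintype.equivFin W) H) ?_
  have hT : ∀ (n : ℕ) (ε : ℝ), ∃ T : GraphTesting.Algorithm n, 0 < ε →
      T.maxQueries ≤ q ε p (Fintype.card W) ∧ (0 < n →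
        ∀ G ∈ GraphTesting.admissibleFamily p (Fintype.card W) n,
          (G ∈ GraphTesting.freeFamily H' n → T.run G true = 1) ∧
          (GraphTesting.IsFar (GraphTesting.freeFamily H') ε G → 2 / 3 ≤ T.run G false)) := by
    rintro (_ | m) ε
    · exact ⟨.accept, fun _ => ⟨Nat.zero_le _, fun h => absurd h (lt_irrefl 0)⟩⟩
    · by_cases hε : 0 < ε
      · obtain ⟨T, h1, h2⟩ := hq ε p _ hε H' m
        exact ⟨T, fun _ => ⟨h1, fun _ => h2⟩⟩
      · exact ⟨.accept, fun h => absurd h hε⟩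
  choose T hT using hT
  exact ⟨T, fun n ε hn hε => (hT n ε hε).2 hn, fun n ε hε => (hT n ε hε).1⟩
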